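/- Let $\gamma>0$. Let $\widehat H$ be the closure in $L^2(\mathbb R)$ of the operator $-\frac{\gamma}{2}(\hat x\hat p+\hat p\hat x)=i\gamma\left(x\frac{d}{dx}+\frac12\right)$, $\hat p=-i\frac{d}{dx}$, with domain the Schwartz space $\mathcal S=\mathcal S(\mathbb R)$. For $n\ge 0$ put $E_n=i\gamma(n+\tfrac12)$ and define the tempered distributions $$f^-_n=\frac{(-i)^n}{\sqrt{n!}}\,\hat p^{\,n}\delta=\frac{(-1)^n}{\sqrt{n!}}\,\delta^{(n)},\qquad f^+_n=\frac{1}{\sqrt{n!}}\,\hat x^{\,n}1=\frac{x^n}{\sqrt{n!}} .$$ For $\phi\in\mathcal S$ and a tempered distribution $T$ write $\langle\phi|T\rangle=T(\overline\phi)$ and $\langle T|\phi\rangle=\overline{\langle\phi|T\rangle}$. Let $F[\phi](k)=\frac1{\sqrt{2\pi}}\int e^{ikx}\phi(x)\,dx$, extended to tempered distributions by $F[T](\phi)=T(F[\phi])$. For real $E$ let $$\psi^E_\pm=\frac1{\sqrt{2\pi\gamma}}\,x_\pm^{-(iE/\gamma+1/2)},$$ where $x_+^\lambda=x^\lambda$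 for $x\ge0$ and $0$ for $x<0$, and $x_-^\lambda=|x|^\lambda$ for $x<0$ and $0$ for $x\ge 0$. A smooth function $f:\mathbb R\to\mathbb C$ is said to be of Hardy class from above, $f\in\mathcal H^2_+$ (from below, $f\in\mathcal H^2_-$), if it is the restriction to $\mathbb R$ of a function that is continuous on the closed upper (lower) half plane, analytic in its interior, and vanishes faster than any power of $|z|$ as $|z|\to\infty$ in the closed half plane. Let $$\Phi_-=\{\phi\in\mathcal S : E\mapsto\langle\psi^E_+|\phi\rangle \text{ and } E\mapsto\langle\psi^E_-|\phi\rangle \text{ belong to } \mathcal H^2_-\},$$ $$\Phi_+=\{\phi\in\mathcal S : E\mapsto\langle F[\psi^{-E}_+]|\phi\rangle\text{ and } E\mapsto\langle F[\psi^{-E}_-]|\phi\rangle \text{ belong to } \mathcal H^2_+\}.$$ Let $\mathcal D=C_c^\infty(\mathbb R)$ and $\mathcal Z=F[\mathcal D]$. Then $\widehat H$ is self-adjoint, and for every $n$ the distributions $f^-_n$ and $f^+_n$ are generalized eigenvectors of $\widehat H$ with generalized eigenvalues $\overline{E_n}=-E_n$ and $E_n$: they are non-zero and satisfy $\langle\widehat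 H\phi|f^-_n\rangle=\overline{E_n}\langle\phi|f^-_n\rangle$ and $\langle\widehat H\phi|f^+_n\rangle=E_n\langle\phi|f^+_n\rangle$ for all $\phi\in\mathcal S$. Moreover $\widehat H$ has the two discrete spectral decompositions $$\widehat H=\sum_{n}\overline{E_n}\,|f^-_n\rangle\langle f^+_n|\ \text{ on }\Phi_-,\qquad \widehat H=\sum_{n}E_n\,|f^+_n\rangle\langle f^-_n|\ \text{ on }\Phi_+,$$ in the following sense. (1) If $\phi\in\Phi_-$, then $\phi$ is in the domain of $\widehat H$ and, for every $\chi\in\Phi_+\cup\mathcal Z$, $$\langle\chi,\widehat H\phi\rangle_{L^2}=\sum_{n=0}^\infty\overline{E_n}\,\langle\chi|f^-_n\rangle\langle f^+_n|\phi\rangle ,$$ the series converging absolutely. (2) If $\phi\in\Phi_+$, then $\phi$ is in the domain of $\widehat H$ and, for every $\chi\in\Phi_-\cup\mathcal D$, $$\langle\chi,\widehat H\phi\rangle_{L^2}=\sum_{n=0}^\infty E_n\,\langle\chi|f^+_n\rangle\langle f^-_n|\phi\rangle ,$$ the series converging absolutely; moreover $\sum_{n}E_n f^+_n(x)\langle f^-_n|\phi\rangle$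 converges locally uniformly on $\mathbb R$, and its sum is $(\widehat H\phi)(x)$ for almost every $x$. -/

import Mathlib

open MeasureTheory Filter Topology Complex
open scoped SchwartzMap ContDiff ComplexConjugate

noncomputable section

namespace DampedQuantum

/-- The Hilbert space `L²(ℝ)`. -/
abbrev L2 : Type := Lp ℂ 2 (volume : Measure ℝ)

/-- The inclusion of the Schwartz space in `L²(ℝ)`. -/
def toL2 : 𝓢(ℝ, ℂ) →L[ℂ] L2 := SchwartzMap.toLpCLM ℂ ℂ 2 (volume : Measure ℝ)

/-! ### The Hamiltonian -/

/-- The position operator `(x̂ φ)(x) = x φ(x)` on Schwartz functions. -/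
def position : 𝓢(ℝ, ℂ) →L[ℂ] 𝓢(ℝ, ℂ) :=
  SchwartzMap.smulLeftCLM ℂ (Complex.ofReal : ℝ → ℂ)

/-- The momentum operator `p̂ φ = -i φ'` on Schwartz functions. -/
def momentum : 𝓢(ℝ, ℂ) →L[ℂ] 𝓢(ℝ, ℂ) :=
  (-I) • SchwartzMap.derivCLM ℂ ℂ

theorem position_apply (φ : 𝓢(ℝ, ℂ)) (x : ℝ) : position φ x = (x : ℂ) * φ x := by
  have h : (Complex.ofReal : ℝ → ℂ).HasTemperateGrowth := Complex.ofRealCLM.hasTemperateGrowth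
  simp [position, SchwartzMap.smulLeftCLM_apply_apply h]

theorem momentum_apply (φ : 𝓢(ℝ, ℂ)) (x : ℝ) : momentum φ x = -I * deriv φ x := by
  simp [momentum]

/-- `-(γ/2) (x̂ p̂ + p̂ x̂)` on Schwartz functions. -/
def hamiltonianSchwartz (γ : ℝ) : 𝓢(ℝ, ℂ) →L[ℂ] 𝓢(ℝ, ℂ) :=
  (-((γ : ℂ) / 2)) • (position ∘L momentum + momentum ∘L position)

theorem hamiltonianSchwartz_apply (γ : ℝ) (φ : 𝓢(ℝ, ℂ)) (x : ℝ) :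
    hamiltonianSchwartz γ φ x = I * γ * (x * deriv φ x + φ x / 2) := by
  have h : deriv (position φ) x = φ x + x * deriv φ x := by
    have e : (position φ : ℝ → ℂ) = fun y : ℝ => (y : ℂ) * φ y := by
      funext y; exact position_apply φ y
    rw [e]
    have h1 : HasDerivAt (fun y : ℝ => (y : ℂ)) 1 x := Complex.ofRealCLM.hasDerivAt
    have h2 : HasDerivAt φ (deriv φ x) x := φ.differentiableAt.hasDerivAt
    have := (h1.mul h2).deriv
    simpa [Pi.mul_def] using this
  simp only [hamiltonianSchwartz, smul_apply, add_apply,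
    ContinuousLinearMap.comp_apply, position_apply, momentum_apply, h, smul_eq_mul]
  ring

/-- `-(γ/2) (x̂ p̂ + p̂ x̂)` as a symmetric operator in `L²(ℝ)` with domain the Schwartz space. -/
def hamiltonianCore (γ : ℝ) : L2 →ₗ.[ℂ] L2 where
  domain := LinearMap.range toL2.toLinearMap
  toFun := toL2.toLinearMap ∘ₗ (hamiltonianSchwartz γ).toLinearMap ∘ₗ
    (LinearEquiv.ofInjective toL2.toLinearMap
      (SchwartzMap.injective_toLp 2 (volume : Measure ℝ))).symm.toLinearMap

/-- The Hamiltonian `Ĥ` in `L²(ℝ)`: the closure of `-(γ/2) (x̂ p̂ + p̂ x̂)` on Schwartz functions. -/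
def hamiltonian (γ : ℝ) : L2 →ₗ.[ℂ] L2 := (hamiltonianCore γ).closure

/-- On a Schwartz function, `Ĥ` acts by `-(γ/2) (x̂ p̂ + p̂ x̂)`. -/
theorem hamiltonian_toL2 (γ : ℝ) (φ : 𝓢(ℝ, ℂ)) :
    ∃ h : toL2 φ ∈ (hamiltonian γ).domain,
      hamiltonian γ ⟨toL2 φ, h⟩ = toL2 (hamiltonianSchwartz γ φ) := by
  have hm : toL2 φ ∈ (hamiltonianCore γ).domain := ⟨φ, rfl⟩
  have hle : hamiltonianCore γ ≤ hamiltonian γ := (hamiltonianCore γ).le_closure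
  refine ⟨hle.1 hm, ?_⟩
  have h2 := hle.2 (x := ⟨toL2 φ, hm⟩) (y := ⟨toL2 φ, hle.1 hm⟩) rfl
  rw [← h2]
  have h3 : (LinearEquiv.ofInjective toL2.toLinearMap
      (SchwartzMap.injective_toLp 2 (volume : Measure ℝ))).symm ⟨toL2 φ, hm⟩ = φ := by
    rw [LinearEquiv.symm_apply_eq]
    rfl
  exact congrArg (fun ξ => toL2 (hamiltonianSchwartz γ ξ)) h3

/-! ### Dirac brackets and generalized eigenvectors -/

/-- Pointwise complex conjugation of a Schwartz function. -/
def conjS (φ : 𝓢(ℝ, ℂ)) : 𝓢(ℝ, ℂ) :=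
  SchwartzMap.postcompCLM (𝕜 := ℝ) (Complex.conjCLE : ℂ →L[ℝ] ℂ) φ

theorem conjS_apply (φ : 𝓢(ℝ, ℂ)) (x : ℝ) : conjS φ x = conj (φ x) := rfl

/-- `⟨φ|T⟩ = "∫ conj (φ x) T(x) dx"` for a Schwartz function `φ` and a tempered
distribution `T`. -/
def ket (φ : 𝓢(ℝ, ℂ)) (T : 𝓢'(ℝ, ℂ)) : ℂ := T (conjS φ)

/-- `⟨T|φ⟩ = conj ⟨φ|T⟩ = "∫ conj (T(x)) φ(x) dx"`. -/
def bra (T : 𝓢'(ℝ, ℂ)) (φ : 𝓢(ℝ, ℂ)) : ℂ := conj (ket φ T)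

/-- `T` is a generalized eigenvector of `A` with generalized eigenvalue `c`: it is non-zero and
`⟨A φ|T⟩ = c ⟨φ|T⟩` for all Schwartz functions `φ`. -/
def IsGeneralizedEigenvector (A : 𝓢(ℝ, ℂ) →L[ℂ] 𝓢(ℝ, ℂ)) (c : ℂ) (T : 𝓢'(ℝ, ℂ)) : Prop :=
  T ≠ 0 ∧ ∀ φ : 𝓢(ℝ, ℂ), ket (A φ) T = c * ket φ T

/-- `E_n = i γ (n + 1/2)`. -/
def energy (γ : ℝ) (n : ℕ) : ℂ := I * γ * (n + 1 / 2)

/-- The position operator on tempered distributions. -/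
def positionDist : 𝓢'(ℝ, ℂ) →L[ℂ] 𝓢'(ℝ, ℂ) :=
  TemperedDistribution.smulLeftCLM ℂ (Complex.ofReal : ℝ → ℂ)

/-- The momentum operator `-i d/dx` on tempered distributions. -/
def momentumDist : 𝓢'(ℝ, ℂ) →L[ℂ] 𝓢'(ℝ, ℂ) :=
  (-I) • TemperedDistribution.derivCLM ℂ

/-- `f⁺_n = (n!)^{-1/2} x̂ⁿ 1`, the distribution `xⁿ / √n!`. -/
def fPlus (n : ℕ) : 𝓢'(ℝ, ℂ) :=
  (1 / (Real.sqrt (n.factorial : ℝ) : ℂ)) •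
    (positionDist ^ n) (volume : Measure ℝ).toTemperedDistribution

/-- `f⁻_n = (-i)ⁿ (n!)^{-1/2} p̂ⁿ δ`, the distribution `(-1)ⁿ δ⁽ⁿ⁾ / √n!`. -/
def fMinus (n : ℕ) : 𝓢'(ℝ, ℂ) :=
  ((-I) ^ n / (Real.sqrt (n.factorial : ℝ) : ℂ)) •
    (momentumDist ^ n) (TemperedDistribution.delta (0 : ℝ))

/-! ### The Fourier transformation -/

/-- The Fourier transformation `F[φ](k) = (2π)^{-1/2} ∫ e^{ikx} φ(x) dx` on Schwartz functions,
obtained from Mathlib's by rescaling; see `fourierS_apply`. -/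
def fourierS : 𝓢(ℝ, ℂ) →L[ℂ] 𝓢(ℝ, ℂ) :=
  ((1 / Real.sqrt (2 * Real.pi) : ℝ) : ℂ) •
    (SchwartzMap.compCLMOfContinuousLinearEquiv ℂ
      (ContinuousLinearEquiv.unitsEquivAut ℝ
        (Units.mk0 (2 * Real.pi)⁻¹ (inv_ne_zero Real.two_pi_pos.ne'))) ∘L
      FourierTransform.fourierInvCLM ℂ 𝓢(ℝ, ℂ))

theorem fourierS_apply (φ : 𝓢(ℝ, ℂ)) (k : ℝ) :
    fourierS φ k = 1 / Real.sqrt (2 * Real.pi) * ∫ x : ℝ, Complex.exp (I * k * x) * φ x := by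
  have h : fourierS φ k = ((1 / Real.sqrt (2 * Real.pi) : ℝ) : ℂ) *
      FourierTransform.fourierInv (φ : ℝ → ℂ) (k * (2 * Real.pi)⁻¹) := by
    rw [← SchwartzMap.fourierInv_coe]
    rfl
  rw [h, Real.fourierInv_eq']
  push_cast
  congr 1
  refine integral_congr_ae (Eventually.of_forall fun x => ?_)
  have hpi : (Real.pi : ℂ) ≠ 0 := by exact_mod_cast Real.pi_ne_zero
  simp only [smul_eq_mul, RCLike.inner_apply, conj_trivial]
  congr 2
  push_cast
  field_simp

/-- The Fourier transformation on tempered distributions, `F[T](φ) = T(F[φ])`. -/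
def fourierDist : 𝓢'(ℝ, ℂ) →L[ℂ] 𝓢'(ℝ, ℂ) :=
  PointwiseConvergenceCLM.precomp ℂ fourierS

/-- Compactly supported smooth functions. -/
def spaceD : Set 𝓢(ℝ, ℂ) := {φ | HasCompactSupport φ}

/-- Fourier transforms of compactly supported smooth functions. -/
def spaceZ : Set 𝓢(ℝ, ℂ) := fourierS '' spaceD

/-! ### Energy eigenvectors -/

/-- `x_+^λ`. -/
def powPlus (l : ℂ) (x : ℝ) : ℂ := if 0 ≤ x then (x : ℂ) ^ l else 0

/-- `x_-^λ`. -/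
def powMinus (l : ℂ) (x : ℝ) : ℂ := if 0 ≤ x then 0 else ((|x| : ℝ) : ℂ) ^ l

theorem measurable_powPlus (l : ℂ) : Measurable (powPlus l) := by
  unfold powPlus
  exact Measurable.ite measurableSet_Ici (by fun_prop) measurable_const

theorem measurable_powMinus (l : ℂ) : Measurable (powMinus l) := by
  unfold powMinus
  exact Measurable.ite measurableSet_Ici measurable_const (by fun_prop)

theorem norm_powPlus_le {l : ℂ} (hl : l.re = -1 / 2) (x : ℝ) :
    ‖powPlus l x‖ ≤ |x| ^ (-1 / 2 : ℝ) := by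
  unfold powPlus
  split_ifs with h
  · rcases h.eq_or_lt with rfl | h
    · have : l ≠ 0 := by rintro rfl; norm_num at hl
      simp only [Complex.ofReal_zero, Complex.zero_cpow this, norm_zero]
      positivity
    · rw [Complex.norm_cpow_eq_rpow_re_of_pos h, hl, abs_of_pos h]
  · rw [norm_zero]; positivity

theorem norm_powMinus_le {l : ℂ} (hl : l.re = -1 / 2) (x : ℝ) :
    ‖powMinus l x‖ ≤ |x| ^ (-1 / 2 : ℝ) := by
  unfold powMinus
  split_ifs with h
  · rw [norm_zero]; positivity
  · have h : 0 < |x| := abs_pos.2 (by intro h0; exact h h0.ge)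
    rw [Complex.norm_cpow_eq_rpow_re_of_pos h, hl]

theorem re_exponent (γ E : ℝ) : (-(I * E / γ + 1 / 2) : ℂ).re = -1 / 2 := by
  have : (I * E / γ : ℂ) = ((E / γ : ℝ) : ℂ) * I := by push_cast; ring
  rw [this]
  simp
  norm_num

/-- An integrable majorant. -/
def weight (t : ℝ) : ℝ := (if t < 1 then t ^ (-1 / 2 : ℝ) else 0) + (1 + t ^ 2)⁻¹

theorem integrable_weight : Integrable (fun x : ℝ => weight |x|) := by
  unfold weight
  refine Integrable.add ?_ ?_
  · have h : IntegrableOn (fun t : ℝ => if t < 1 then t ^ (-1 / 2 : ℝ) else 0) (Set.Ioi 0) := by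
      have h1 : IntegrableOn (fun t : ℝ => t ^ (-1 / 2 : ℝ)) (Set.Ioo 0 1) :=
        (intervalIntegral.integrableOn_Ioo_rpow_iff one_pos).2 (by norm_num)
      have h2 := (h1.integrable_indicator measurableSet_Ioo).integrableOn (s := Set.Ioi (0 : ℝ))
      refine h2.congr_fun (fun t ht => ?_) measurableSet_Ioi
      have ht : 0 < t := ht
      by_cases h1 : t < 1 <;> simp [Set.indicator, ht, h1]
    have hpos : IntegrableOn (fun x : ℝ => if |x| < 1 then |x| ^ (-1 / 2 : ℝ) else 0)
        (Set.Ioi 0) := by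
      refine h.congr_fun (fun t ht => ?_) measurableSet_Ioi
      have ht : 0 < t := ht
      simp [abs_of_pos ht]
    have hneg : IntegrableOn (fun x : ℝ => if |x| < 1 then |x| ^ (-1 / 2 : ℝ) else 0)
        (Set.Iic 0) := by
      rw [← Measure.map_neg_eq_self (volume : Measure ℝ)]
      have m : MeasurableEmbedding fun x : ℝ => -x := (Homeomorph.neg ℝ).measurableEmbedding
      rw [m.integrableOn_map_iff]
      simp_rw [Function.comp_def, abs_neg, Set.neg_preimage, Set.neg_Iic, neg_zero]
      exact Iff.mpr integrableOn_Ici_iff_integrableOn_Ioi hpos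
    rw [← integrableOn_univ, ← Set.Iic_union_Ioi (a := (0 : ℝ))]
    exact hneg.union hpos
  · simpa using integrable_inv_one_add_sq

theorem norm_mul_le_weight {g : ℝ → ℂ} (hb : ∀ x, ‖g x‖ ≤ |x| ^ (-1 / 2 : ℝ))
    (φ : 𝓢(ℝ, ℂ)) (x : ℝ) :
    ‖g x * φ x‖ ≤
      weight |x| * (SchwartzMap.seminorm ℂ 0 0 φ + SchwartzMap.seminorm ℂ 2 0 φ) := by
  have h0 : ‖φ x‖ ≤ SchwartzMap.seminorm ℂ 0 0 φ := SchwartzMap.norm_le_seminorm ℂ φ x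
  have h2 : |x| ^ 2 * ‖φ x‖ ≤ SchwartzMap.seminorm ℂ 2 0 φ := by
    simpa using SchwartzMap.norm_pow_mul_le_seminorm ℂ φ 2 x
  have hp0 : 0 ≤ SchwartzMap.seminorm ℂ 0 0 φ := (norm_nonneg _).trans h0
  have hp2 : 0 ≤ SchwartzMap.seminorm ℂ 2 0 φ := le_trans (by positivity) h2
  rw [norm_mul]
  have hw : 0 ≤ (1 + |x| ^ 2)⁻¹ := by positivity
  have hr : 0 ≤ |x| ^ (-1 / 2 : ℝ) := by positivity
  unfold weight
  split_ifs with h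
  · calc ‖g x‖ * ‖φ x‖ ≤ |x| ^ (-1 / 2 : ℝ) * SchwartzMap.seminorm ℂ 0 0 φ :=
        mul_le_mul (hb x) h0 (norm_nonneg _) hr
      _ ≤ _ := by
        apply mul_le_mul <;> linarith
  · have hg : ‖g x‖ ≤ 1 :=
      (hb x).trans (Real.rpow_le_one_of_one_le_of_nonpos (not_lt.1 h) (by norm_num))
    have hd : ‖φ x‖ ≤ (1 + |x| ^ 2)⁻¹ *
        (SchwartzMap.seminorm ℂ 0 0 φ + SchwartzMap.seminorm ℂ 2 0 φ) := by
      rw [inv_mul_eq_div, le_div_iff₀ (by positivity)]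
      linarith
    calc ‖g x‖ * ‖φ x‖ ≤ 1 * ‖φ x‖ := by gcongr
      _ ≤ _ := by rw [one_mul, zero_add]; exact hd

theorem integrable_mul {g : ℝ → ℂ} (hg : Measurable g) (hb : ∀ x, ‖g x‖ ≤ |x| ^ (-1 / 2 : ℝ))
    (φ : 𝓢(ℝ, ℂ)) : Integrable (fun x => g x * φ x) :=
  (integrable_weight.mul_const _).mono'
    (hg.aestronglyMeasurable.mul φ.continuous.aestronglyMeasurable)
    (Eventually.of_forall (norm_mul_le_weight hb φ))

theorem norm_integral_mul_le {g : ℝ → ℂ} (hb : ∀ x, ‖g x‖ ≤ |x| ^ (-1 / 2 : ℝ)) :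
    ∃ (s : Finset (ℕ × ℕ)) (C : ℝ), 0 ≤ C ∧ ∀ φ : 𝓢(ℝ, ℂ),
      ‖∫ x, g x * φ x‖ ≤ C * s.sup (schwartzSeminormFamily ℂ ℝ ℂ) φ := by
  have hw : 0 ≤ ∫ x : ℝ, weight |x| := integral_nonneg fun x => by
    simp only [weight]
    split_ifs <;> positivity
  refine ⟨{(0, 0), (2, 0)}, (∫ x : ℝ, weight |x|) * 2, by positivity, fun φ => ?_⟩
  have h1 : SchwartzMap.seminorm ℂ 0 0 φ ≤
      (({(0, 0), (2, 0)} : Finset (ℕ × ℕ)).sup (schwartzSeminormFamily ℂ ℝ ℂ)) φ :=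
    Seminorm.le_def.1 (Finset.le_sup (f := schwartzSeminormFamily ℂ ℝ ℂ)
      (show ((0, 0) : ℕ × ℕ) ∈ ({(0, 0), (2, 0)} : Finset (ℕ × ℕ)) by simp)) φ
  have h2 : SchwartzMap.seminorm ℂ 2 0 φ ≤
      (({(0, 0), (2, 0)} : Finset (ℕ × ℕ)).sup (schwartzSeminormFamily ℂ ℝ ℂ)) φ :=
    Seminorm.le_def.1 (Finset.le_sup (f := schwartzSeminormFamily ℂ ℝ ℂ)
      (show ((2, 0) : ℕ × ℕ) ∈ ({(0, 0), (2, 0)} : Finset (ℕ × ℕ)) by simp)) φ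
  calc ‖∫ x, g x * φ x‖
      ≤ ∫ x : ℝ, weight |x| * (SchwartzMap.seminorm ℂ 0 0 φ + SchwartzMap.seminorm ℂ 2 0 φ) :=
        norm_integral_le_of_norm_le (integrable_weight.mul_const _)
          (Eventually.of_forall (norm_mul_le_weight hb φ))
    _ = (∫ x : ℝ, weight |x|) *
        (SchwartzMap.seminorm ℂ 0 0 φ + SchwartzMap.seminorm ℂ 2 0 φ) := integral_mul_const _ _
    _ ≤ _ := by
      rw [mul_assoc]
      gcongr
      linarith

/-- The tempered distribution `φ ↦ ∫ g φ` of a measurable `g` with `|g(x)| ≤ |x|^{-1/2}`. -/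
def regularDist (g : ℝ → ℂ) (hg : Measurable g) (hb : ∀ x, ‖g x‖ ≤ |x| ^ (-1 / 2 : ℝ)) :
    𝓢'(ℝ, ℂ) :=
  ContinuousLinearMap.toPointwiseConvergenceCLM _ _ _ _
    (SchwartzMap.mkCLMtoNormedSpace (𝕜 := ℂ) (fun φ : 𝓢(ℝ, ℂ) => ∫ x, g x * φ x)
      (fun φ χ => by
        simp only [add_apply, mul_add]
        exact integral_add (integrable_mul hg hb φ) (integrable_mul hg hb χ))
      (fun a φ => by
        simp only [smul_apply, smul_eq_mul, RingHom.id_apply,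
          ← integral_const_mul]
        congr 1
        funext x
        ring)
      (norm_integral_mul_le hb))

theorem regularDist_apply (g : ℝ → ℂ) (hg : Measurable g)
    (hb : ∀ x, ‖g x‖ ≤ |x| ^ (-1 / 2 : ℝ)) (φ : 𝓢(ℝ, ℂ)) :
    regularDist g hg hb φ = ∫ x, g x * φ x := rfl

/-- `ψ^E_+ = (2πγ)^{-1/2} x_+^{-(iE/γ + 1/2)}` for real `E`. -/
def psiPlus (γ E : ℝ) : 𝓢'(ℝ, ℂ) :=
  (1 / (Real.sqrt (2 * Real.pi * γ) : ℂ)) •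
    regularDist (powPlus (-(I * E / γ + 1 / 2))) (measurable_powPlus _)
      (norm_powPlus_le (re_exponent γ E))

/-- `ψ^E_- = (2πγ)^{-1/2} x_-^{-(iE/γ + 1/2)}` for real `E`. -/
def psiMinus (γ E : ℝ) : 𝓢'(ℝ, ℂ) :=
  (1 / (Real.sqrt (2 * Real.pi * γ) : ℂ)) •
    regularDist (powMinus (-(I * E / γ + 1 / 2))) (measurable_powMinus _)
      (norm_powMinus_le (re_exponent γ E))

/-! ### Hardy classes and the spaces `Φ_±` -/

/-- The Hardy class from above: smooth functions on `ℝ` that are the boundary values of a function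
continuous on `Im z ≥ 0`, analytic on `Im z > 0`, and vanishing faster than any power of `z`
as `|z| → ∞` in `Im z ≥ 0`. -/
def HardyAbove (f : ℝ → ℂ) : Prop :=
  ContDiff ℝ ∞ f ∧ ∃ g : ℂ → ℂ,
    ContinuousOn g {z | 0 ≤ z.im} ∧ DifferentiableOn ℂ g {z | 0 < z.im} ∧
    (∀ E : ℝ, g E = f E) ∧
    ∀ k : ℕ, Tendsto (fun z => ‖z‖ ^ k * ‖g z‖) (Bornology.cobounded ℂ ⊓ 𝓟 {z | 0 ≤ z.im}) (𝓝 0)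

/-- The Hardy class from below: the same with the lower half plane. -/
def HardyBelow (f : ℝ → ℂ) : Prop :=
  ContDiff ℝ ∞ f ∧ ∃ g : ℂ → ℂ,
    ContinuousOn g {z | z.im ≤ 0} ∧ DifferentiableOn ℂ g {z | z.im < 0} ∧
    (∀ E : ℝ, g E = f E) ∧
    ∀ k : ℕ, Tendsto (fun z => ‖z‖ ^ k * ‖g z‖) (Bornology.cobounded ℂ ⊓ 𝓟 {z | z.im ≤ 0}) (𝓝 0)

/-- `Φ_-`: Schwartz functions `φ` such that `E ↦ ⟨ψ^E_±|φ⟩` are of Hardy class from below. -/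
def PhiMinus (γ : ℝ) : Set 𝓢(ℝ, ℂ) :=
  {φ | HardyBelow (fun E => bra (psiPlus γ E) φ) ∧ HardyBelow (fun E => bra (psiMinus γ E) φ)}

/-- `Φ_+`: Schwartz functions `φ` such that `E ↦ ⟨F[ψ^{-E}_±]|φ⟩` are of Hardy class from above. -/
def PhiPlus (γ : ℝ) : Set 𝓢(ℝ, ℂ) :=
  {φ | HardyAbove (fun E => bra (fourierDist (psiPlus γ (-E))) φ) ∧
    HardyAbove (fun E => bra (fourierDist (psiMinus γ (-E))) φ)}

end DampedQuantum

end

/-! The Hardy conditions are support conditions in disguise. The brackets ⟨ψ^E_±|φ⟩ are, up to a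
constant, the Mellin transforms of φ(±x) at s = 1/2 + iE/γ, and the lower half plane in E is the
half plane Re s ≥ 1/2. Mellin inversion writes φ(±x) as an integral over real E containing the
factor exp(-iE log x/γ). For x > 1 this factor is bounded in the lower half plane, so the contour
can be pushed away and the integral vanishes. Hence every φ in Φ_- is supported in [-1,1], and
`PhiMinus_subset_spaceD` gives Φ_- ⊆ D. Transporting by the Fourier transformation gives Φ_+ ⊆ Z
(`PhiPlus_subset_spaceZ`).

It remains to pair Z with D. An element of Z is the Fourier transform of a compactly supported
function, so its derivatives at 0 are moments, bounded by C Mⁿ, and it equals its Taylor series. The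
operator x d/dx + 1/2 multiplies xⁿ by n + 1/2, so Ĥφ = ∑ E_n f⁺_n ⟨f⁻_n|φ⟩ pointwise. Against a
compactly supported χ the series may be integrated termwise (`hasSum_moments`). The other
decomposition is the complex conjugate of this one, with φ and χ exchanged, because Ĥ is symmetric.

Self-adjointness follows from the basic criterion at ±iγ/2, where the first-order operator factors:
Ĥ + iγ/2 = iγ (d/dx)x and Ĥ - iγ/2 = iγ x(d/dx). A vector orthogonal to either range is a constant
on each half-line, or a constant divided by x. No such function other than 0 is square integrable.
-/

noncomputable section

namespace DampedQuantum

/-! ### Algebra of position, derivative and conjugation -/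

/-- The derivative on Schwartz functions. -/
abbrev derivS : 𝓢(ℝ, ℂ) →L[ℂ] 𝓢(ℝ, ℂ) := SchwartzMap.derivCLM ℂ ℂ

theorem derivS_position (φ : 𝓢(ℝ, ℂ)) :
    derivS (position φ) = φ + position (derivS φ) := by
  ext x
  have e : (position φ : ℝ → ℂ) = fun y : ℝ => (y : ℂ) * φ y := funext (position_apply φ)
  have h1 : HasDerivAt (fun y : ℝ => (y : ℂ)) 1 x := Complex.ofRealCLM.hasDerivAt
  have := (h1.mul (φ.hasDerivAt x)).deriv
  simpa [e, position_apply, Pi.mul_def] using this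

theorem hamiltonianSchwartz_eq (γ : ℝ) (φ : 𝓢(ℝ, ℂ)) :
    hamiltonianSchwartz γ φ = (I * γ) • (position (derivS φ) + (1 / 2 : ℂ) • φ) := by
  ext x
  simp only [hamiltonianSchwartz_apply, smul_apply, add_apply, position_apply,
    SchwartzMap.derivCLM_apply, smul_eq_mul]
  ring

theorem conjS_conjS (φ : 𝓢(ℝ, ℂ)) : conjS (conjS φ) = φ := by
  ext x; simp [conjS_apply]

theorem conjS_add (φ ψ : 𝓢(ℝ, ℂ)) : conjS (φ + ψ) = conjS φ + conjS ψ := by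
  ext x; simp [conjS_apply]

theorem conjS_smul (c : ℂ) (φ : 𝓢(ℝ, ℂ)) : conjS (c • φ) = conj c • conjS φ := by
  ext x; simp [conjS_apply]

theorem conjS_position (φ : 𝓢(ℝ, ℂ)) : conjS (position φ) = position (conjS φ) := by
  ext x; simp [conjS_apply, position_apply]

theorem conjS_derivS (φ : 𝓢(ℝ, ℂ)) : conjS (derivS φ) = derivS (conjS φ) := by
  ext x
  have h : HasDerivAt (conjS φ) (conj (deriv φ x)) x :=
    (Complex.conjCLE : ℂ →L[ℝ] ℂ).hasFDerivAt.comp_hasDerivAt x (φ.hasDerivAt x)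
  simp [conjS_apply, h.deriv]

/-- The operator is i times one with real coefficients. The resulting sign is what assigns -E_n to
`fMinus` and E_n to `fPlus`. -/
theorem conjS_hamiltonianSchwartz (γ : ℝ) (φ : 𝓢(ℝ, ℂ)) :
    conjS (hamiltonianSchwartz γ φ) = -hamiltonianSchwartz γ (conjS φ) := by
  have h2 : conj (1 / 2 : ℂ) = 1 / 2 := by rw [map_div₀, map_one, map_ofNat]
  rw [hamiltonianSchwartz_eq, hamiltonianSchwartz_eq, conjS_smul, conjS_add, conjS_position,
    conjS_derivS, conjS_smul, h2, map_mul, conj_I, conj_ofReal, neg_mul, neg_smul]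

theorem position_pow_apply (n : ℕ) (φ : 𝓢(ℝ, ℂ)) (x : ℝ) :
    (position ^ n) φ x = (x : ℂ) ^ n * φ x := by
  induction n with
  | zero => simp
  | succ n ih => rw [pow_succ', mul_apply_eq_comp, position_apply, ih, pow_succ', mul_assoc]

/-- This is [Dⁿ, xD] = n Dⁿ, a consequence of [D, x] = 1. Evaluated at 0, where the term x D Dⁿφ
drops out, it makes δ⁽ⁿ⁾ an eigenvector of the dilation generator. -/
theorem derivS_pow_position (n : ℕ) (φ : 𝓢(ℝ, ℂ)) :
    (derivS ^ n) (position (derivS φ)) =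
      position (derivS ((derivS ^ n) φ)) + (n : ℂ) • (derivS ^ n) φ := by
  induction n with
  | zero => simp
  | succ n ih =>
    rw [pow_succ', mul_apply_eq_comp, ih, map_add, derivS_position, map_smul,
      mul_apply_eq_comp]
    push_cast
    module

theorem conjS_derivS_pow (n : ℕ) (φ : 𝓢(ℝ, ℂ)) :
    conjS ((derivS ^ n) φ) = (derivS ^ n) (conjS φ) := by
  induction n with
  | zero => simp
  | succ n ih => rw [pow_succ', mul_apply_eq_comp, mul_apply_eq_comp, conjS_derivS, ih]

theorem derivS_position_pow (n : ℕ) (φ : 𝓢(ℝ, ℂ)) :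
    derivS ((position ^ n) (position φ)) =
      (position ^ n) (position (derivS φ)) + ((n : ℂ) + 1) • (position ^ n) φ := by
  induction n generalizing φ with
  | zero => simp [derivS_position, add_comm]
  | succ n ih =>
    rw [pow_succ, mul_apply_eq_comp, ih, derivS_position,
      mul_apply_eq_comp, mul_apply_eq_comp, map_add, map_add]
    push_cast
    module

theorem integral_derivS (φ : 𝓢(ℝ, ℂ)) : ∫ x, derivS φ x = 0 := by
  exact integral_eq_zero_of_hasDerivAt_of_integrable
    (fun x => by simpa using φ.hasDerivAt x) (derivS φ).integrable φ.integrable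

/-! ### The distributions `f^±_n` -/

theorem momentumDist_pow_apply (n : ℕ) (T : 𝓢'(ℝ, ℂ)) (ψ : 𝓢(ℝ, ℂ)) :
    (momentumDist ^ n) T ψ = I ^ n * T ((derivS ^ n) ψ) := by
  induction n generalizing ψ with
  | zero => simp
  | succ n ih =>
    rw [pow_succ', mul_apply_eq_comp]
    simp only [momentumDist, smul_apply, TemperedDistribution.derivCLM_apply_apply] at ih ⊢
    rw [ih, map_neg, map_neg, pow_succ, pow_succ, mul_apply_eq_comp]
    simp only [smul_eq_mul]
    ring

theorem positionDist_pow_apply (n : ℕ) (T : 𝓢'(ℝ, ℂ)) (ψ : 𝓢(ℝ, ℂ)) :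
    (positionDist ^ n) T ψ = T ((position ^ n) ψ) := by
  induction n generalizing ψ with
  | zero => simp
  | succ n ih =>
    rw [pow_succ', mul_apply_eq_comp, pow_succ, mul_apply_eq_comp, ← ih]
    rfl

theorem fMinus_apply (n : ℕ) (ψ : 𝓢(ℝ, ℂ)) :
    fMinus n ψ = (derivS ^ n) ψ 0 / (Real.sqrt (n.factorial : ℝ) : ℂ) := by
  have h : (-I) ^ n * I ^ n = 1 := by rw [← mul_pow]; simp
  change ((-I) ^ n / (Real.sqrt (n.factorial : ℝ) : ℂ)) *
    (momentumDist ^ n) (TemperedDistribution.delta (0 : ℝ)) ψ = _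
  rw [momentumDist_pow_apply, TemperedDistribution.delta_apply]
  linear_combination ((derivS ^ n) ψ 0 / (Real.sqrt (n.factorial : ℝ) : ℂ)) * h

theorem fPlus_apply (n : ℕ) (ψ : 𝓢(ℝ, ℂ)) :
    fPlus n ψ = (∫ x : ℝ, (x : ℂ) ^ n * ψ x) / (Real.sqrt (n.factorial : ℝ) : ℂ) := by
  change (1 / (Real.sqrt (n.factorial : ℝ) : ℂ)) *
    (positionDist ^ n) (volume : Measure ℝ).toTemperedDistribution ψ = _
  have h (χ : 𝓢(ℝ, ℂ)) : (volume : Measure ℝ).toTemperedDistribution χ = ∫ x, χ x :=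
    Measure.toTemperedDistribution_apply _ χ
  rw [positionDist_pow_apply, h]
  simp only [position_pow_apply]
  ring

theorem ket_fMinus (n : ℕ) (φ : 𝓢(ℝ, ℂ)) :
    ket φ (fMinus n) = conj ((derivS ^ n) φ 0) / (Real.sqrt (n.factorial : ℝ) : ℂ) := by
  rw [ket, fMinus_apply, ← conjS_derivS_pow, conjS_apply]

theorem bra_fMinus (n : ℕ) (φ : 𝓢(ℝ, ℂ)) :
    bra (fMinus n) φ = (derivS ^ n) φ 0 / (Real.sqrt (n.factorial : ℝ) : ℂ) := by
  simp [bra, ket_fMinus]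

theorem ket_fPlus (n : ℕ) (φ : 𝓢(ℝ, ℂ)) :
    ket φ (fPlus n) =
      (∫ x : ℝ, (x : ℂ) ^ n * conj (φ x)) / (Real.sqrt (n.factorial : ℝ) : ℂ) := by
  simp only [ket, fPlus_apply, conjS_apply]

theorem energy_conj (γ : ℝ) (n : ℕ) : conj (energy γ n) = -energy γ n := by
  have h2 : conj ((n : ℂ) + 1 / 2) = n + 1 / 2 := by
    rw [map_add, map_div₀, map_one, map_ofNat, map_natCast]
  rw [energy, map_mul, map_mul, h2, conj_I, conj_ofReal]
  ring

theorem ket_hamiltonianSchwartz_fMinus (γ : ℝ) (n : ℕ) (φ : 𝓢(ℝ, ℂ)) :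
    ket (hamiltonianSchwartz γ φ) (fMinus n) = conj (energy γ n) * ket φ (fMinus n) := by
  rw [energy_conj, ket, ket, conjS_hamiltonianSchwartz, map_neg, fMinus_apply, fMinus_apply,
    hamiltonianSchwartz_eq, map_smul, map_add, derivS_pow_position, map_smul]
  simp only [smul_apply, add_apply, position_apply, energy, smul_eq_mul]
  push_cast
  ring

/-- Integration by parts: the derivative of xⁿ⁺¹ψ has integral zero. -/
theorem integral_pow_mul_position_derivS (n : ℕ) (ψ : 𝓢(ℝ, ℂ)) :
    ∫ x : ℝ, (x : ℂ) ^ n * position (derivS ψ) x = -(n + 1) * ∫ x : ℝ, (x : ℂ) ^ n * ψ x := by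
  have h := integral_derivS ((position ^ n) (position ψ))
  rw [derivS_position_pow] at h
  simp only [add_apply, smul_apply, smul_eq_mul] at h
  rw [integral_add (SchwartzMap.integrable _) ((SchwartzMap.integrable _).const_mul _),
    integral_const_mul] at h
  simp only [position_pow_apply] at h
  linear_combination h

theorem ket_hamiltonianSchwartz_fPlus (γ : ℝ) (n : ℕ) (φ : 𝓢(ℝ, ℂ)) :
    ket (hamiltonianSchwartz γ φ) (fPlus n) = energy γ n * ket φ (fPlus n) := by
  rw [ket, ket, conjS_hamiltonianSchwartz, map_neg, hamiltonianSchwartz_eq, map_smul, map_add,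
    map_smul, fPlus_apply, fPlus_apply, integral_pow_mul_position_derivS]
  simp only [energy, smul_eq_mul]
  ring

/-- A Schwartz function whose `n`-th moment does not vanish. -/
theorem exists_moment_ne_zero (n : ℕ) :
    ∃ ψ : 𝓢(ℝ, ℂ), ∫ x : ℝ, (x : ℂ) ^ n * ψ x ≠ 0 := by
  let b : ContDiffBump (0 : ℝ) := ⟨1, 2, one_pos, one_lt_two⟩
  have hs : HasCompactSupport (fun x : ℝ => (b x : ℂ)) :=
    b.hasCompactSupport.comp_left (g := Complex.ofReal) rfl
  have hd : ContDiff ℝ ∞ (fun x : ℝ => (b x : ℂ)) := Complex.ofRealCLM.contDiff.comp b.contDiff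
  -- The extra factor xⁿ makes the integrand x²ⁿ b(x) ≥ 0, so that odd n causes no cancellation.
  refine ⟨(position ^ n) (hs.toSchwartzMap hd), ?_⟩
  have e : ∀ x : ℝ, (x : ℂ) ^ n * (position ^ n) (hs.toSchwartzMap hd) x =
      (((x ^ n) ^ 2 * b x : ℝ) : ℂ) := fun x => by
    rw [position_pow_apply]
    have : (hs.toSchwartzMap hd) x = (b x : ℂ) := rfl
    rw [this]
    push_cast
    ring
  simp_rw [e]
  rw [integral_complex_ofReal, Complex.ofReal_ne_zero]
  have hc : Continuous fun x : ℝ => (x ^ n) ^ 2 * b x := by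
    have := b.continuous
    fun_prop
  refine (hc.integral_pos_of_hasCompactSupport_nonneg_nonzero b.hasCompactSupport.mul_left
    (fun x => mul_nonneg (sq_nonneg _) b.nonneg) (x := 1) ?_).ne'
  have : b 1 = 1 := b.one_of_mem_closedBall (by simp [b])
  simp [this]

/-! ### The Fourier transformation -/

theorem fourierS_eq_fourierInv (φ : 𝓢(ℝ, ℂ)) (k : ℝ) :
    fourierS φ k = ((1 / Real.sqrt (2 * Real.pi) : ℝ) : ℂ) *
      FourierTransform.fourierInv φ (k * (2 * Real.pi)⁻¹) := rfl

theorem conjS_fourierS_conjS (φ : 𝓢(ℝ, ℂ)) (k : ℝ) :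
    conjS (fourierS (conjS φ)) k = ((1 / Real.sqrt (2 * Real.pi) : ℝ) : ℂ) *
      FourierTransform.fourier φ (k * (2 * Real.pi)⁻¹) := by
  rw [conjS_apply, fourierS_eq_fourierInv, map_mul, conj_ofReal]
  congr 1
  rw [SchwartzMap.fourierInv_coe, SchwartzMap.fourier_coe, Real.fourierInv_eq', Real.fourier_eq',
    ← integral_conj]
  refine integral_congr_ae (Eventually.of_forall fun x => ?_)
  simp only [smul_eq_mul, map_mul, conjS_apply, conj_conj, ← Complex.exp_conj, conj_I, conj_ofReal]
  congr 2
  push_cast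
  ring

/-- Conjugating on both sides turns the kernel e^{ikx} into e^{-ikx}, so `conjS ∘ fourierS ∘ conjS`
is the inverse Fourier transformation. -/
theorem fourierS_conjS_fourierS_conjS (φ : 𝓢(ℝ, ℂ)) :
    fourierS (conjS (fourierS (conjS φ))) = φ := by
  ext k
  have hinv : ∫ x : ℝ, Complex.exp (2 * Real.pi * (k * x : ℝ) * I) *
      FourierTransform.fourier φ x = φ k := by
    conv_rhs => rw [← FourierTransform.fourierInv_fourier_eq (F := 𝓢(ℝ, ℂ)) φ]
    rw [SchwartzMap.fourierInv_coe, Real.fourierInv_eq']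
    refine integral_congr_ae (Eventually.of_forall fun x => ?_)
    simp only [smul_eq_mul, RCLike.inner_apply, conj_trivial]
    congr 2
    push_cast
    ring
  rw [fourierS_apply]
  -- The substitution y = x/(2π) has Jacobian 2π, which cancels the two normalising factors
  -- (2π)^{-1/2}.
  have h := Measure.integral_comp_mul_right (fun y : ℝ =>
    Complex.exp (2 * Real.pi * (k * y : ℝ) * I) * FourierTransform.fourier φ y) (2 * Real.pi)⁻¹
  rw [hinv, inv_inv, abs_of_pos Real.two_pi_pos] at h
  have e : ∀ x : ℝ, Complex.exp (I * k * x) * conjS (fourierS (conjS φ)) x =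
      ((1 / Real.sqrt (2 * Real.pi) : ℝ) : ℂ) *
      (Complex.exp (2 * Real.pi * (k * (x * (2 * Real.pi)⁻¹) : ℝ) * I) *
        FourierTransform.fourier φ (x * (2 * Real.pi)⁻¹)) := fun x => by
    rw [conjS_fourierS_conjS]
    have : (I * k * x : ℂ) = 2 * Real.pi * (k * (x * (2 * Real.pi)⁻¹) : ℝ) * I := by
      have hpi' : (Real.pi : ℂ) ≠ 0 := by exact_mod_cast Real.pi_ne_zero
      push_cast
      field_simp
    rw [this]
    ring
  simp_rw [e]
  rw [integral_const_mul, h, real_smul]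
  have hs : (1 / Real.sqrt (2 * Real.pi)) * (1 / Real.sqrt (2 * Real.pi)) * (2 * Real.pi) = 1 := by
    have := Real.mul_self_sqrt Real.two_pi_pos.le
    field_simp
    nlinarith
  have hs' : (1 / (Real.sqrt (2 * Real.pi) : ℂ)) * ((1 / Real.sqrt (2 * Real.pi) : ℝ) : ℂ) *
      ((2 * Real.pi : ℝ) : ℂ) = 1 := by
    exact_mod_cast congrArg Complex.ofReal hs
  linear_combination φ k * hs'

theorem derivS_fourierS (η : 𝓢(ℝ, ℂ)) :
    derivS (fourierS η) = fourierS (I • position η) := by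
  ext k
  set a : ℝ := (2 * Real.pi)⁻¹
  have hpi : (Real.pi : ℂ) ≠ 0 := by exact_mod_cast Real.pi_ne_zero
  have h1 : deriv (FourierTransform.fourierInv η) (k * a) =
      FourierTransform.fourierInv ((2 * Real.pi * I) • position η) (k * a) := by
    have h := congrArg (fun f : 𝓢(ℝ, ℂ) => f (k * a)) (SchwartzMap.lineDerivOp_fourierInv_eq η 1)
    simp only [SchwartzMap.lineDerivOp_apply_eq_fderiv, fderiv_apply_one_eq_deriv] at h
    rw [h]
    congr 2
    ext x
    have : (fun x : ℝ => inner ℝ x (1 : ℝ)).HasTemperateGrowth :=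
      ((innerSL ℝ).flip (1 : ℝ)).hasTemperateGrowth
    rw [smul_apply, smul_apply, SchwartzMap.smulLeftCLM_apply_apply this, position_apply]
    simp
  have h2 : HasDerivAt (fourierS η) (((1 / Real.sqrt (2 * Real.pi) : ℝ) : ℂ) *
      (a • deriv (FourierTransform.fourierInv η) (k * a))) k := by
    have h3 : HasDerivAt (fun y : ℝ => y * a) a k := by
      simpa using (hasDerivAt_id k).mul_const a
    exact (((FourierTransform.fourierInv η).hasDerivAt (k * a)).scomp k h3).const_mul _
  rw [SchwartzMap.derivCLM_apply, h2.deriv, h1, fourierS_eq_fourierInv]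
  have h4 (c : ℂ) (ψ : 𝓢(ℝ, ℂ)) : FourierTransform.fourierInv (c • ψ) =
      c • FourierTransform.fourierInv ψ :=
    map_smul (FourierTransform.fourierInvCLM ℂ 𝓢(ℝ, ℂ)) c ψ
  rw [h4, h4, smul_apply, smul_apply, real_smul]
  simp only [a, smul_eq_mul]
  push_cast
  field_simp

theorem derivS_pow_fourierS (n : ℕ) (η : 𝓢(ℝ, ℂ)) :
    (derivS ^ n) (fourierS η) = fourierS (I ^ n • (position ^ n) η) := by
  induction n with
  | zero => simp
  | succ n ih =>
    rw [pow_succ', mul_apply_eq_comp, ih, derivS_fourierS, map_smul position, smul_smul,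
      pow_succ' position, mul_apply_eq_comp, pow_succ' I]

theorem derivS_pow_fourierS_zero (n : ℕ) (η : 𝓢(ℝ, ℂ)) :
    (derivS ^ n) (fourierS η) 0 =
      1 / Real.sqrt (2 * Real.pi) * ∫ x : ℝ, (I * x) ^ n * η x := by
  rw [derivS_pow_fourierS, fourierS_apply]
  congr 1
  refine integral_congr_ae (Eventually.of_forall fun x => ?_)
  simp only [ofReal_zero, mul_zero, zero_mul, Complex.exp_zero, one_mul, smul_apply,
    position_pow_apply, smul_eq_mul, mul_pow, mul_assoc]

/-! ### Generalized eigenvectors -/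

theorem sqrt_factorial_ne_zero (n : ℕ) : (Real.sqrt (n.factorial : ℝ) : ℂ) ≠ 0 :=
  ofReal_ne_zero.2 (Real.sqrt_ne_zero'.2 (by exact_mod_cast n.factorial_pos))

theorem isGeneralizedEigenvector_fMinus (γ : ℝ) (n : ℕ) :
    IsGeneralizedEigenvector (hamiltonianSchwartz γ) (conj (energy γ n)) (fMinus n) := by
  refine ⟨fun h => ?_, ket_hamiltonianSchwartz_fMinus γ n⟩
  obtain ⟨η, hη⟩ := exists_moment_ne_zero n
  -- The n-th derivative at 0 of a Fourier transform is a nonzero multiple of the n-th moment of η,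
  -- so one test function serves both families.
  have h0 : fMinus n (fourierS η) = 0 := by rw [h]; rfl
  rw [fMinus_apply, div_eq_zero_iff, or_iff_left (sqrt_factorial_ne_zero n),
    derivS_pow_fourierS_zero] at h0
  simp_rw [mul_pow, mul_assoc] at h0
  rw [integral_const_mul] at h0
  have hpi : (Real.sqrt (2 * Real.pi) : ℂ) ≠ 0 :=
    ofReal_ne_zero.2 (Real.sqrt_ne_zero'.2 Real.two_pi_pos)
  exact mul_ne_zero (one_div_ne_zero hpi) (mul_ne_zero (pow_ne_zero _ I_ne_zero) hη) h0

theorem isGeneralizedEigenvector_fPlus (γ : ℝ) (n : ℕ) :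
    IsGeneralizedEigenvector (hamiltonianSchwartz γ) (energy γ n) (fPlus n) := by
  refine ⟨fun h => ?_, ket_hamiltonianSchwartz_fPlus γ n⟩
  obtain ⟨η, hη⟩ := exists_moment_ne_zero n
  have h0 : fPlus n η = 0 := by rw [h]; rfl
  rw [fPlus_apply] at h0
  exact div_ne_zero hη (sqrt_factorial_ne_zero n) h0

/-! ### Contour shifts and the Paley–Wiener property of `Φ_±` -/

section Contour

variable {g : ℂ → ℂ}

theorem exists_norm_sq_mul_le_one
    (h : Tendsto (fun z => ‖z‖ ^ 2 * ‖g z‖) (Bornology.cobounded ℂ ⊓ 𝓟 {z | z.im ≤ 0}) (𝓝 0)) :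
    ∃ R : ℝ, 1 ≤ R ∧ ∀ z : ℂ, z.im ≤ 0 → R ≤ ‖z‖ → ‖z‖ ^ 2 * ‖g z‖ ≤ 1 := by
  have h1 := h.eventually (eventually_le_nhds zero_lt_one)
  rw [eventually_inf_principal, ← comap_norm_atTop, eventually_comap] at h1
  obtain ⟨R, hR⟩ := eventually_atTop.1 h1
  exact ⟨max R 1, le_max_right _ _, fun z hz hzR => hR _ ((le_max_left _ _).trans hzR) z rfl hz⟩

theorem integrable_of_decay (hc : ContinuousOn g {z | z.im ≤ 0})
    (h : Tendsto (fun z => ‖z‖ ^ 2 * ‖g z‖) (Bornology.cobounded ℂ ⊓ 𝓟 {z | z.im ≤ 0}) (𝓝 0)) :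
    Integrable (fun E : ℝ => g E) := by
  obtain ⟨R, hR1, hR⟩ := exists_norm_sq_mul_le_one h
  have hcr : Continuous fun E : ℝ => g E :=
    hc.comp_continuous continuous_ofReal fun E => by simp
  have hc2 : Continuous fun E : ℝ => (1 + E ^ 2) * ‖g E‖ :=
    (by fun_prop : Continuous fun E : ℝ => 1 + E ^ 2).mul hcr.norm
  obtain ⟨C, hC⟩ := (isCompact_Icc (a := -R) (b := R)).exists_bound_of_continuousOn hc2.continuousOn
  refine (integrable_inv_one_add_sq.const_mul (max C 2)).mono' hcr.aestronglyMeasurable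
    (Eventually.of_forall fun E => ?_)
  rw [← div_eq_mul_inv, le_div_iff₀ (by positivity), mul_comm]
  rcases le_total |E| R with hE | hE
  · exact ((le_abs_self _).trans (hC E (abs_le.1 hE))).trans (le_max_left _ _)
  · refine le_trans ?_ (le_max_right _ _)
    have h2 := hR E (by simp) (by simpa using hE)
    rw [norm_real, Real.norm_eq_abs, sq_abs] at h2
    have h3 : 1 ≤ E ^ 2 := by
      rw [← sq_abs]
      nlinarith [hR1.trans hE]
    nlinarith [norm_nonneg (g E)]

/-- For L ≥ 0 the factor e^{-izL} has modulus at most 1 in the lower half plane, so the quadratic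
decay of g alone lets the contour be closed there. -/
theorem integral_exp_mul_eq_zero (hc : ContinuousOn g {z | z.im ≤ 0})
    (hd : DifferentiableOn ℂ g {z | z.im < 0})
    (h : Tendsto (fun z => ‖z‖ ^ 2 * ‖g z‖) (Bornology.cobounded ℂ ⊓ 𝓟 {z | z.im ≤ 0}) (𝓝 0))
    {L : ℝ} (hL : 0 ≤ L) : ∫ E : ℝ, Complex.exp (-I * E * L) * g E = 0 := by
  obtain ⟨R₀, hR1, hR⟩ := exists_norm_sq_mul_le_one h
  set f : ℂ → ℂ := fun z => Complex.exp (-I * z * L) * g z with hf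
  have hexp : ∀ z : ℂ, z.im ≤ 0 → ‖f z‖ ≤ ‖g z‖ := fun z hz => by
    rw [hf, norm_mul, Complex.norm_exp]
    refine mul_le_of_le_one_left (norm_nonneg _) (Real.exp_le_one_iff.2 ?_)
    simpa using mul_nonpos_of_nonpos_of_nonneg hz hL
  have hfc : ContinuousOn f {z | z.im ≤ 0} :=
    ContinuousOn.mul (by fun_prop) hc
  have hfd : DifferentiableOn ℂ f {z | z.im < 0} :=
    DifferentiableOn.mul (by fun_prop) hd
  have hcr : Continuous fun E : ℝ => f E :=
    hfc.comp_continuous continuous_ofReal fun E => by simp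
  have hint : Integrable (fun E : ℝ => f E) :=
    (integrable_of_decay hc h).mono hcr.aestronglyMeasurable
      (Eventually.of_forall fun E => hexp E (by simp))
  have hlim := intervalIntegral_tendsto_integral hint tendsto_neg_atTop_atBot tendsto_id
  -- Cauchy's theorem is applied on [-R,R] × [-R,0]. The three sides off the real axis have lengths
  -- 2R, R, R and lie in |z| ≥ R, where the integrand is at most 1/R²; together they contribute at
  -- most 4/R.
  refine tendsto_nhds_unique hlim (squeeze_zero_norm' (a := fun R : ℝ => 4 / R) ?_ ?_)
  swap
  · exact tendsto_const_nhds.div_atTop tendsto_id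
  filter_upwards [eventually_ge_atTop R₀] with R hRR
  have hR0 : 0 < R := by linarith
  have hbd : ∀ z : ℂ, z.im ≤ 0 → R ≤ ‖z‖ → ‖f z‖ ≤ 1 / R ^ 2 := fun z hz hzR => by
    refine (hexp z hz).trans ?_
    rw [le_div_iff₀ (by positivity), mul_comm]
    refine le_trans ?_ (hR z hz (hRR.trans hzR))
    gcongr
  have hrect := Complex.integral_boundary_rect_eq_zero_of_continuousOn_of_differentiableOn f
    (⟨-R, -R⟩ : ℂ) (⟨R, 0⟩ : ℂ)
    (hfc.mono fun z hz => by
      have := hz.2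
      rw [Set.mem_preimage, Set.uIcc_of_le (by simpa using hR0.le)] at this
      exact this.2)
    (hfd.mono fun z hz => by
      have := hz.2.2
      rwa [max_eq_right (by simpa using hR0.le)] at this)
  simp only [ofReal_zero, zero_mul, add_zero] at hrect
  have b1 : ‖∫ x : ℝ in (-R)..R, f (x + (-R : ℝ) * I)‖ ≤ 1 / R ^ 2 * |R - -R| :=
    intervalIntegral.norm_integral_le_of_norm_le_const fun x _ => hbd _ (by simpa using hR0.le) (by
      refine le_trans ?_ (Complex.abs_im_le_norm _)
      simp [abs_of_pos hR0])
  have b2 : ‖∫ y : ℝ in (-R)..0, f ((R : ℝ) + y * I)‖ ≤ 1 / R ^ 2 * |0 - -R| :=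
    intervalIntegral.norm_integral_le_of_norm_le_const fun y hy => hbd _ (by
      rw [Set.uIoc_of_le (by linarith)] at hy
      simpa using hy.2) (by
      refine le_trans ?_ (Complex.abs_re_le_norm _)
      simp [abs_of_pos hR0])
  have b3 : ‖∫ y : ℝ in (-R)..0, f ((-R : ℝ) + y * I)‖ ≤ 1 / R ^ 2 * |0 - -R| :=
    intervalIntegral.norm_integral_le_of_norm_le_const fun y hy => hbd _ (by
      rw [Set.uIoc_of_le (by linarith)] at hy
      simpa using hy.2) (by
      refine le_trans ?_ (Complex.abs_re_le_norm _)
      simp [abs_of_pos hR0])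
  have e : ∫ x : ℝ in (-R)..R, f x = (∫ x : ℝ in (-R)..R, f (x + (-R : ℝ) * I)) +
      I * (∫ y : ℝ in (-R)..0, f ((R : ℝ) + y * I)) -
      I * (∫ y : ℝ in (-R)..0, f ((-R : ℝ) + y * I)) := by
    simp only [smul_eq_mul] at hrect
    linear_combination -hrect
  simp only [id]
  rw [e]
  refine (norm_sub_le _ _).trans ((add_le_add_left (norm_add_le _ _) _).trans ?_)
  rw [norm_mul, norm_mul, norm_I, one_mul, one_mul]
  have e1 : |R - -R| = 2 * R := by rw [sub_neg_eq_add, abs_of_pos (by linarith)]; ring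
  have e2 : |0 - -R| = R := by rw [sub_neg_eq_add, zero_add, abs_of_pos hR0]
  rw [e1] at b1
  rw [e2] at b2 b3
  have e3 : 4 / R = 1 / R ^ 2 * (2 * R) + 1 / R ^ 2 * R + 1 / R ^ 2 * R := by
    field_simp
    ring
  rw [e3]
  linarith

end Contour

/-- A function whose Mellin transform is of Hardy class in `Re s ≥ 1/2` vanishes beyond `1`. -/
theorem eq_zero_of_hardyBelow_mellin {γ : ℝ} (hγ : 0 < γ) {c : ℂ} (hc : c ≠ 0) {f : ℝ → ℂ}
    (hf : Continuous f) (hm : MellinConvergent f ((1 / 2 : ℝ) : ℂ))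
    (hH : HardyBelow fun E => c * mellin f (1 / 2 + I * E / γ)) {x : ℝ} (hx : 1 < x) : f x = 0 := by
  obtain ⟨-, g, gc, gd, gE, gdec⟩ := hH
  have hγ' : (γ : ℂ) ≠ 0 := ofReal_ne_zero.2 hγ.ne'
  have hM : ∀ y : ℝ, mellin f (((1 / 2 : ℝ) : ℂ) + y * I) = c⁻¹ * g ((γ * y : ℝ) : ℂ) := fun y => by
    rw [gE, inv_mul_cancel_left₀ hc]
    congr 1
    push_cast
    field_simp
  have hint := integrable_of_decay gc (gdec 2)
  have hV : VerticalIntegrable (mellin f) (1 / 2) := by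
    unfold VerticalIntegrable
    simp_rw [hM]
    exact (hint.comp_mul_left' hγ.ne').const_mul _
  have hx0 : 0 < x := by linarith
  rw [← mellinInv_mellin_eq (1 / 2) f hx0 hm hV hf.continuousAt, mellinInv]
  simp_rw [hM]
  have hxc : (x : ℂ) ≠ 0 := ofReal_ne_zero.2 hx0.ne'
  -- With E = γy, the kernel of Mellin inversion is x^{-1/2} exp(-iEL) for L = log x/γ, and x > 1
  -- makes L nonnegative.
  have e : ∀ y : ℝ, (x : ℂ) ^ (-(((1 / 2 : ℝ) : ℂ) + y * I)) • (c⁻¹ * g ((γ * y : ℝ) : ℂ)) =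
      (x : ℂ) ^ (-((1 / 2 : ℝ) : ℂ)) * c⁻¹ *
        (Complex.exp (-I * ((γ * y : ℝ) : ℂ) * ((Real.log x / γ : ℝ) : ℂ)) *
          g ((γ * y : ℝ) : ℂ)) := fun y => by
    have : Complex.exp (-I * ((γ * y : ℝ) : ℂ) * ((Real.log x / γ : ℝ) : ℂ)) =
        (x : ℂ) ^ (-(y * I)) := by
      rw [cpow_def_of_ne_zero hxc, ← ofReal_log hx0.le]
      congr 1
      push_cast
      field_simp
    rw [this, neg_add, cpow_add _ _ hxc, smul_eq_mul]
    ring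
  simp_rw [e]
  rw [integral_const_mul, Measure.integral_comp_mul_left (fun E : ℝ =>
    Complex.exp (-I * (E : ℂ) * ((Real.log x / γ : ℝ) : ℂ)) * g (E : ℂ)),
    integral_exp_mul_eq_zero gc gd (gdec 2) (div_nonneg (Real.log_nonneg hx.le) hγ.le)]
  simp

/-! ### Energy brackets as Mellin transforms -/

theorem conj_ofReal_cpow {t : ℝ} (ht : 0 < t) (l : ℂ) : conj ((t : ℂ) ^ l) = (t : ℂ) ^ (conj l) := by
  rw [cpow_conj _ _ (by rw [arg_ofReal_of_nonneg ht.le]; exact Real.pi_pos.ne), conj_ofReal]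

theorem conj_exponent (γ E : ℝ) :
    conj (-(I * E / γ + 1 / 2) : ℂ) = (1 / 2 + I * E / γ) - 1 := by
  have h2 : conj (1 / 2 : ℂ) = 1 / 2 := by rw [map_div₀, map_one, map_ofNat]
  rw [map_neg, map_add, h2, map_div₀, map_mul, conj_I, conj_ofReal, conj_ofReal]
  ring

theorem bra_smul_regularDist (c : ℝ) (g : ℝ → ℂ) (hg : Measurable g)
    (hb : ∀ x, ‖g x‖ ≤ |x| ^ (-1 / 2 : ℝ)) (φ : 𝓢(ℝ, ℂ)) :
    bra ((1 / (c : ℂ)) • regularDist g hg hb) φ = 1 / (c : ℂ) * ∫ x, conj (g x) * φ x := by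
  have : ket φ ((1 / (c : ℂ)) • regularDist g hg hb) =
      1 / (c : ℂ) * ∫ x, g x * conjS φ x := rfl
  rw [bra, this, map_mul, ← integral_conj, map_div₀, map_one, conj_ofReal]
  simp_rw [map_mul, conjS_apply, conj_conj]

theorem bra_psiPlus (γ E : ℝ) (φ : 𝓢(ℝ, ℂ)) :
    bra (psiPlus γ E) φ =
      1 / (Real.sqrt (2 * Real.pi * γ) : ℂ) * mellin φ (1 / 2 + I * E / γ) := by
  rw [psiPlus, bra_smul_regularDist, mellin, ← integral_indicator measurableSet_Ioi]
  congr 1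
  have h0 : ∀ᵐ x : ℝ, x ≠ 0 := by simp [ae_iff]
  refine integral_congr_ae ?_
  filter_upwards [h0] with x hx
  by_cases h : 0 < x
  · rw [Set.indicator_of_mem (Set.mem_Ioi.2 h), powPlus, if_pos h.le, conj_ofReal_cpow h,
      conj_exponent, smul_eq_mul]
  · have h' : ¬ 0 ≤ x := fun h1 => h (lt_of_le_of_ne h1 hx.symm)
    rw [Set.indicator_of_notMem (by simpa using h), powPlus, if_neg h', map_zero, zero_mul]

theorem bra_psiMinus (γ E : ℝ) (φ : 𝓢(ℝ, ℂ)) :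
    bra (psiMinus γ E) φ =
      1 / (Real.sqrt (2 * Real.pi * γ) : ℂ) * mellin (fun x => φ (-x)) (1 / 2 + I * E / γ) := by
  rw [psiMinus, bra_smul_regularDist, mellin, ← integral_indicator measurableSet_Ioi,
    ← integral_neg_eq_self]
  congr 1
  refine integral_congr_ae (Eventually.of_forall fun x => ?_)
  by_cases h : 0 < x
  · simp only [powMinus]
    rw [Set.indicator_of_mem (Set.mem_Ioi.2 h), if_neg (by linarith), abs_neg,
      abs_of_pos h, conj_ofReal_cpow h, conj_exponent, smul_eq_mul]
  · simp only [powMinus]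
    rw [Set.indicator_of_notMem (by simpa using h), if_pos (by linarith), map_zero, zero_mul]

theorem mellinConvergent_schwartz (φ : 𝓢(ℝ, ℂ)) : MellinConvergent φ ((1 / 2 : ℝ) : ℂ) := by
  have hre : (((1 / 2 : ℝ) : ℂ) - 1).re = -1 / 2 := by
    rw [sub_re, ofReal_re, one_re]; norm_num
  refine (integrable_mul (measurable_powPlus _) (norm_powPlus_le hre) φ).integrableOn.congr_fun
    (fun x hx => ?_) measurableSet_Ioi
  simp only [powPlus]
  rw [if_pos (le_of_lt hx), smul_eq_mul]

/-- Reflection `x ↦ -x` of a Schwartz function. -/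
def reflectS : 𝓢(ℝ, ℂ) →L[ℂ] 𝓢(ℝ, ℂ) :=
  SchwartzMap.compCLMOfContinuousLinearEquiv ℂ (ContinuousLinearEquiv.neg ℝ)

/-- The two Hardy conditions control the two half-lines separately and confine the support to
[-1,1]. -/
theorem PhiMinus_subset_spaceD {γ : ℝ} (hγ : 0 < γ) : PhiMinus γ ⊆ spaceD := by
  rintro φ ⟨h1, h2⟩
  have hc : 1 / (Real.sqrt (2 * Real.pi * γ) : ℂ) ≠ 0 := by
    refine one_div_ne_zero (ofReal_ne_zero.2 (Real.sqrt_ne_zero'.2 ?_))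
    have := Real.two_pi_pos
    positivity
  simp_rw [bra_psiPlus] at h1
  simp_rw [bra_psiMinus] at h2
  refine HasCompactSupport.intro (isCompact_Icc (a := (-1 : ℝ)) (b := 1)) fun x hx => ?_
  rw [Set.mem_Icc, not_and_or, not_le, not_le] at hx
  rcases hx with hx | hx
  · simpa using eq_zero_of_hardyBelow_mellin hγ hc (φ.continuous.comp continuous_neg)
      (mellinConvergent_schwartz (reflectS φ)) h2 (x := -x) (by linarith)
  · exact eq_zero_of_hardyBelow_mellin hγ hc φ.continuous (mellinConvergent_schwartz φ) h1 hx

/-- Since Φ_+ is defined with ψ^{-E}, the reflection E ↦ -E turns its Hardy condition from above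
into the condition from below that defines Φ_-. -/
theorem HardyAbove.comp_neg {f : ℝ → ℂ} (h : HardyAbove f) : HardyBelow fun E => f (-E) := by
  obtain ⟨hs, g, gc, gd, gE, gdec⟩ := h
  refine ⟨hs.comp contDiff_neg, fun z => g (-z), gc.comp continuous_neg.continuousOn
    fun z hz => ?_, gd.comp differentiable_neg.differentiableOn fun z hz => ?_, fun E => ?_,
    fun k => ?_⟩
  · simpa using hz
  · simpa using hz
  · simp only [← gE, ofReal_neg]
  · have ht : Tendsto (fun z : ℂ => -z) (Bornology.cobounded ℂ ⊓ 𝓟 {z | z.im ≤ 0})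
        (Bornology.cobounded ℂ ⊓ 𝓟 {z | 0 ≤ z.im}) := by
      refine tendsto_inf.2 ⟨tendsto_inf_left tendsto_neg_cobounded,
        tendsto_principal.2 (eventually_inf_principal.2 (Eventually.of_forall fun z hz => ?_))⟩
      simpa using hz
    simpa [Function.comp_def] using (gdec k).comp ht

theorem bra_fourierDist (T : 𝓢'(ℝ, ℂ)) (φ : 𝓢(ℝ, ℂ)) :
    bra (fourierDist T) φ = bra T (conjS (fourierS (conjS φ))) := by
  have : ket (conjS (fourierS (conjS φ))) T = T (fourierS (conjS φ)) := by
    rw [ket, conjS_conjS]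
  rw [bra, bra, this]
  rfl

theorem PhiPlus_subset_spaceZ {γ : ℝ} (hγ : 0 < γ) : PhiPlus γ ⊆ spaceZ := by
  rintro φ ⟨h1, h2⟩
  -- The preimage is the inverse Fourier transform of φ. Its brackets with ψ^E are those of φ with
  -- F[ψ^E], so it belongs to Φ_-.
  refine ⟨conjS (fourierS (conjS φ)), PhiMinus_subset_spaceD hγ ⟨?_, ?_⟩,
    fourierS_conjS_fourierS_conjS φ⟩
  · simpa [bra_fourierDist] using h1.comp_neg
  · simpa [bra_fourierDist] using h2.comp_neg

/-! ### Expansion of functions of exponential type -/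

/-- This is z d/dz + 1/2 applied termwise to the exponential series. -/
theorem hasSum_add_half_mul_pow_div_factorial (z : ℂ) :
    HasSum (fun n : ℕ => ((n : ℂ) + 1 / 2) / n.factorial * z ^ n) ((z + 1 / 2) * Complex.exp z) := by
  have h1 : HasSum (fun n : ℕ => z ^ n / n.factorial) (Complex.exp z) := by
    rw [Complex.exp_eq_exp_ℂ]
    exact NormedSpace.expSeries_div_hasSum_exp z
  have h2 : HasSum (fun n : ℕ => (n : ℂ) * (z ^ n / n.factorial)) (z * Complex.exp z) := by
    rw [← hasSum_nat_add_iff' 1]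
    simp only [Finset.sum_range_one, Nat.cast_zero, zero_mul, sub_zero]
    refine (h1.mul_left z).congr_fun fun n => ?_
    have h3 : (n.factorial : ℂ) ≠ 0 := by exact_mod_cast n.factorial_ne_zero
    have h4 : (n : ℂ) + 1 ≠ 0 := by exact_mod_cast n.succ_ne_zero
    rw [Nat.factorial_succ]
    push_cast
    field_simp
    rw [pow_succ']
  rw [add_mul]
  refine (h2.add (h1.mul_left (1 / 2))).congr_fun fun n => ?_
  ring

theorem summable_add_half_mul_pow_div_factorial (M : ℝ) :
    Summable fun n : ℕ => ((n : ℝ) + 1 / 2) / n.factorial * M ^ n := by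
  refine Complex.summable_ofReal.1 ?_
  push_cast
  exact (hasSum_add_half_mul_pow_div_factorial (M : ℂ)).summable

theorem exists_abs_le_of_mem_spaceD {η : 𝓢(ℝ, ℂ)} (hη : η ∈ spaceD) :
    ∃ R : ℝ, 0 ≤ R ∧ ∀ x, η x ≠ 0 → |x| ≤ R := by
  obtain ⟨R, hR⟩ := (show HasCompactSupport η from hη).isCompact.isBounded.subset_closedBall 0
  refine ⟨max R 0, le_max_right _ _, fun x hx => le_max_of_le_left ?_⟩
  simpa using hR (subset_tsupport _ hx)

theorem norm_pow_mul_le {η : 𝓢(ℝ, ℂ)} {R : ℝ} (hη : ∀ x, η x ≠ 0 → |x| ≤ R) (n : ℕ) (x : ℝ) :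
    ‖(x : ℂ) ^ n * η x‖ ≤ R ^ n * ‖η x‖ := by
  by_cases h : η x = 0
  · simp [h]
  · rw [norm_mul, norm_pow, norm_real, Real.norm_eq_abs]
    gcongr
    exact hη x h

/-- Termwise integration of a power series of an entire function of exponential type against a
compactly supported function. -/
theorem hasSum_moments {η : 𝓢(ℝ, ℂ)} (hη : η ∈ spaceD) {b : ℕ → ℂ} {C M : ℝ}
    (hb : ∀ n, ‖b n‖ ≤ C * M ^ n) {f : ℝ → ℂ}
    (hf : ∀ x : ℝ, HasSum (fun n : ℕ => ((n : ℂ) + 1 / 2) / n.factorial * (b n * (x : ℂ) ^ n))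
      (f x)) :
    HasSum (fun n : ℕ => ((n : ℂ) + 1 / 2) / n.factorial * (b n * ∫ x : ℝ, (x : ℂ) ^ n * η x))
      (∫ x, f x * η x) := by
  obtain ⟨R, hR0, hR⟩ := exists_abs_le_of_mem_spaceD hη
  have hpi : ∀ n : ℕ, Integrable fun x : ℝ => (x : ℂ) ^ n * η x := fun n =>
    ((position ^ n) η).integrable.congr (Eventually.of_forall (position_pow_apply n η))
  set F : ℕ → ℝ → ℂ := fun n x =>
    ((n : ℂ) + 1 / 2) / n.factorial * (b n * ((x : ℂ) ^ n * η x)) with hF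
  have hFi : ∀ n, Integrable (F n) := fun n => ((hpi n).const_mul _).const_mul _
  -- The support of η lies in [-R,R], so the n-th term costs at most (MR)ⁿ(n + 1/2)/n!. This is
  -- summable and justifies exchanging sum and integral.
  have hFn : ∀ n, ∫ x, ‖F n x‖ ≤
      ((n : ℝ) + 1 / 2) / n.factorial * (M * R) ^ n * (C * ∫ x, ‖η x‖) := fun n => by
    rw [mul_assoc, mul_pow, ← integral_const_mul, ← integral_const_mul, ← integral_const_mul]
    refine integral_mono (hFi n).norm
      (((η.integrable.norm.const_mul _).const_mul _).const_mul _) fun x => ?_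
    have h1 := norm_pow_mul_le hR n x
    have h2 : ‖((n : ℂ) + 1 / 2) / n.factorial‖ = ((n : ℝ) + 1 / 2) / n.factorial := by
      have : ((n : ℂ) + 1 / 2) / n.factorial = ((((n : ℝ) + 1 / 2) / n.factorial : ℝ) : ℂ) := by
        push_cast; rfl
      rw [this, norm_real, Real.norm_of_nonneg (by positivity)]
    simp only [hF]
    rw [norm_mul, h2, norm_mul]
    have h3 := mul_le_mul (hb n) h1 (norm_nonneg _) ((norm_nonneg _).trans (hb n))
    refine mul_le_mul_of_nonneg_left (h3.trans_eq ?_) (by positivity)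
    ring
  have hs : Summable fun n => ∫ x, ‖F n x‖ :=
    Summable.of_nonneg_of_le (fun n => integral_nonneg fun x => norm_nonneg _) hFn
      ((summable_add_half_mul_pow_div_factorial (M * R)).mul_right _)
  have h := hasSum_integral_of_summable_integral_norm hFi hs
  have e : ∀ x, ∑' n, F n x = f x * η x := fun x => by
    rw [← ((hf x).mul_right (η x)).tsum_eq]
    exact tsum_congr fun n => by simp only [hF]; ring
  simp_rw [e] at h
  refine h.congr_fun fun n => ?_
  simp only [hF]
  rw [integral_const_mul, integral_const_mul]

/-- The easy half of Paley–Wiener: these derivatives are moments of a function supported in [-R,R],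
so M = R works. -/
theorem exists_norm_derivS_pow_zero_le {φ : 𝓢(ℝ, ℂ)} (hφ : φ ∈ spaceZ) :
    ∃ C M : ℝ, 0 ≤ C ∧ 0 ≤ M ∧ ∀ n, ‖(derivS ^ n) φ 0‖ ≤ C * M ^ n := by
  obtain ⟨η, hη, rfl⟩ := hφ
  obtain ⟨R, hR0, hR⟩ := exists_abs_le_of_mem_spaceD hη
  refine ⟨‖(1 / Real.sqrt (2 * Real.pi) : ℂ)‖ * ∫ x, ‖η x‖, R, by positivity, hR0, fun n => ?_⟩
  rw [derivS_pow_fourierS_zero, norm_mul, mul_assoc]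
  gcongr
  rw [mul_comm, ← integral_const_mul]
  refine norm_integral_le_of_norm_le (η.integrable.norm.const_mul _)
    (Eventually.of_forall fun x => ?_)
  refine le_trans (le_of_eq ?_) (norm_pow_mul_le hR n x)
  simp [mul_pow]

/-- The action of `x d/dx + 1/2` on a function of exponential type, as a power series. -/
theorem hasSum_dilation_generator {φ : 𝓢(ℝ, ℂ)} (hφ : φ ∈ spaceZ) (x : ℝ) :
    HasSum (fun n : ℕ => ((n : ℂ) + 1 / 2) / n.factorial * ((derivS ^ n) φ 0 * (x : ℂ) ^ n))
      (x * deriv φ x + φ x / 2) := by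
  obtain ⟨η, hη, rfl⟩ := hφ
  have hb : ∀ n : ℕ, ‖(I * x) ^ n‖ ≤ 1 * |x| ^ n := fun n => by simp
  -- The function f(t) is x d/dx + 1/2 applied to e^{ixt}. Its expansion in powers of t is
  -- integrated against η, with b_n = (ix)ⁿ.
  have h := (hasSum_moments hη hb (f := fun t => (I * x * t + 1 / 2) * Complex.exp (I * x * t))
    fun t => by
      refine (hasSum_add_half_mul_pow_div_factorial (I * x * t)).congr_fun fun n => ?_
      rw [mul_pow _ (t : ℂ)]).mul_left (1 / Real.sqrt (2 * Real.pi) : ℂ)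
  have e : (1 / Real.sqrt (2 * Real.pi) : ℂ) *
      ∫ t : ℝ, (I * x * t + 1 / 2) * Complex.exp (I * x * t) * η t =
      x * deriv (fourierS η) x + fourierS η x / 2 := by
    have hi (ψ : 𝓢(ℝ, ℂ)) : Integrable fun t : ℝ => Complex.exp (I * x * t) * ψ t := by
      refine ψ.integrable.mono (by fun_prop) (Eventually.of_forall fun t => ?_)
      rw [norm_mul, show I * x * t = ((x * t : ℝ) : ℂ) * I by push_cast; ring,
        norm_exp_ofReal_mul_I, one_mul]
    rw [← SchwartzMap.derivCLM_apply ℂ, derivS_fourierS, fourierS_apply, fourierS_apply]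
    have : ∀ t : ℝ, (I * x * t + 1 / 2) * Complex.exp (I * x * t) * η t =
        x * (Complex.exp (I * x * t) * (I • position η) t) +
          1 / 2 * (Complex.exp (I * x * t) * η t) := fun t => by
      rw [smul_apply, position_apply, smul_eq_mul]
      ring
    simp_rw [this]
    rw [integral_add ((hi _).const_mul _) ((hi _).const_mul _), integral_const_mul,
      integral_const_mul]
    ring
  rw [e] at h
  refine h.congr_fun fun n => ?_
  rw [derivS_pow_fourierS_zero]
  simp_rw [mul_pow, mul_assoc]
  rw [integral_const_mul]
  ring

/-! ### Symmetry of the Hamiltonian and the two expansions -/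

theorem inner_toL2 (φ ψ : 𝓢(ℝ, ℂ)) : inner ℂ (toL2 φ) (toL2 ψ) = ∫ x, ψ x * conj (φ x) := by
  have : inner ℂ (toL2 φ) (toL2 ψ) = ∫ x, inner ℂ (φ x) (ψ x) := SchwartzMap.inner_toL2_toL2_eq φ ψ
  rw [this]
  rfl

theorem integral_hamiltonianSchwartz_mul (γ : ℝ) (u v : 𝓢(ℝ, ℂ)) :
    ∫ x, hamiltonianSchwartz γ u x * v x = -∫ x, u x * hamiltonianSchwartz γ v x := by
  have h := SchwartzMap.integral_mul_deriv_eq_neg_deriv_mul u (position v)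
  have hi (f g : 𝓢(ℝ, ℂ)) : Integrable fun x => f x * g x :=
    (f.memLp 2).integrable_mul (g.memLp 2)
  have h1 : ∀ x, u x * deriv (position v) x = u x * v x + u x * position (derivS v) x := fun x => by
    rw [← SchwartzMap.derivCLM_apply ℂ, derivS_position, add_apply, mul_add]
  have h2 : ∀ x, deriv u x * position v x = position (derivS u) x * v x := fun x => by
    rw [position_apply, position_apply, SchwartzMap.derivCLM_apply]
    ring
  simp_rw [h1, h2] at h
  rw [integral_add (hi _ _) (hi _ _)] at h
  have h3 : ∀ x, hamiltonianSchwartz γ u x * v x =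
      I * γ * (position (derivS u) x * v x) + I * γ / 2 * (u x * v x) := fun x => by
    rw [hamiltonianSchwartz_eq]
    simp only [smul_apply, add_apply, smul_eq_mul]
    ring
  have h4 : ∀ x, u x * hamiltonianSchwartz γ v x =
      I * γ * (u x * position (derivS v) x) + I * γ / 2 * (u x * v x) := fun x => by
    rw [hamiltonianSchwartz_eq]
    simp only [smul_apply, add_apply, smul_eq_mul]
    ring
  simp_rw [h3, h4]
  rw [integral_add ((hi _ _).const_mul _) ((hi _ _).const_mul _),
    integral_add ((hi _ _).const_mul _) ((hi _ _).const_mul _)]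
  simp_rw [integral_const_mul]
  linear_combination I * γ * h

theorem inner_hamiltonianSchwartz (γ : ℝ) (φ ψ : 𝓢(ℝ, ℂ)) :
    inner ℂ (toL2 (hamiltonianSchwartz γ φ)) (toL2 ψ) =
      inner ℂ (toL2 φ) (toL2 (hamiltonianSchwartz γ ψ)) := by
  rw [inner_toL2, inner_toL2]
  simp_rw [← conjS_apply, conjS_hamiltonianSchwartz]
  rw [integral_hamiltonianSchwartz_mul]
  simp [integral_neg]

theorem sqrt_factorial_mul_self (n : ℕ) :
    (Real.sqrt (n.factorial : ℝ) : ℂ) * Real.sqrt (n.factorial : ℝ) = n.factorial := by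
  rw [← ofReal_mul, Real.mul_self_sqrt (by positivity), ofReal_natCast]

/-- The power series of Ĥφ is integrated termwise against the conjugate of χ; the factors 1/√n! of
`fPlus` and `fMinus` combine to the Taylor factor 1/n!. -/
theorem hasSum_energy_fPlus_fMinus (γ : ℝ) {φ χ : 𝓢(ℝ, ℂ)} (hφ : φ ∈ spaceZ) (hχ : χ ∈ spaceD) :
    HasSum (fun n : ℕ => energy γ n * (ket χ (fPlus n) * bra (fMinus n) φ))
      (inner ℂ (toL2 χ) (toL2 (hamiltonianSchwartz γ φ))) := by
  obtain ⟨C, M, -, -, hb⟩ := exists_norm_derivS_pow_zero_le hφ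
  have hc : conjS χ ∈ spaceD :=
    HasCompactSupport.comp_left (g := conj) (show HasCompactSupport χ from hχ) (map_zero _)
  have h := (hasSum_moments hc hb (hasSum_dilation_generator hφ)).mul_left (I * γ)
  rw [inner_toL2]
  have e : ∫ x, hamiltonianSchwartz γ φ x * conj (χ x) =
      I * γ * ∫ x : ℝ, (x * deriv φ x + φ x / 2) * conjS χ x := by
    rw [← integral_const_mul]
    simp_rw [hamiltonianSchwartz_apply, conjS_apply, mul_assoc]
  rw [e]
  refine h.congr_fun fun n => ?_
  rw [ket_fPlus, bra_fMinus, energy, ← sqrt_factorial_mul_self]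
  simp_rw [conjS_apply]
  have := sqrt_factorial_ne_zero n
  field_simp

/-- No second expansion is needed: symmetry moves Ĥ onto χ, and the previous series is conjugated
with φ and χ exchanged. -/
theorem hasSum_energy_fMinus_fPlus (γ : ℝ) {φ χ : 𝓢(ℝ, ℂ)} (hφ : φ ∈ spaceD) (hχ : χ ∈ spaceZ) :
    HasSum (fun n : ℕ => conj (energy γ n) * (ket χ (fMinus n) * bra (fPlus n) φ))
      (inner ℂ (toL2 χ) (toL2 (hamiltonianSchwartz γ φ))) := by
  rw [← inner_hamiltonianSchwartz, ← inner_conj_symm]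
  refine (Complex.hasSum_conj'.2 (hasSum_energy_fPlus_fMinus γ hχ hφ)).congr_fun fun n => ?_
  simp only [map_mul, bra, conj_conj]
  ring

theorem tendstoLocallyUniformly_energy (γ : ℝ) {φ : 𝓢(ℝ, ℂ)} (hφ : φ ∈ spaceZ) :
    TendstoLocallyUniformly
      (fun (N : ℕ) (x : ℝ) => ∑ n ∈ Finset.range N, energy γ n *
        ((x : ℂ) ^ n / (Real.sqrt (n.factorial : ℝ) : ℂ) * bra (fMinus n) φ))
      (hamiltonianSchwartz γ φ) atTop := by
  obtain ⟨C, M, hC, hM, hb⟩ := exists_norm_derivS_pow_zero_le hφ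
  have e : ∀ (n : ℕ) (x : ℝ), energy γ n *
      ((x : ℂ) ^ n / (Real.sqrt (n.factorial : ℝ) : ℂ) * bra (fMinus n) φ) =
      I * γ * (((n : ℂ) + 1 / 2) / n.factorial * ((derivS ^ n) φ 0 * (x : ℂ) ^ n)) := fun n x => by
    rw [bra_fMinus, energy, ← sqrt_factorial_mul_self]
    have := sqrt_factorial_ne_zero n
    field_simp
  simp_rw [e]
  have hsum : (hamiltonianSchwartz γ φ : ℝ → ℂ) = fun x : ℝ => ∑' n : ℕ,
      I * γ * (((n : ℂ) + 1 / 2) / n.factorial * ((derivS ^ n) φ 0 * (x : ℂ) ^ n)) := by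
    funext x
    rw [((hasSum_dilation_generator hφ x).mul_left (I * γ)).tsum_eq, hamiltonianSchwartz_apply]
  rw [hsum, tendstoLocallyUniformly_iff_forall_isCompact]
  intro K hK
  obtain ⟨R, hR⟩ := hK.isBounded.subset_closedBall 0
  -- Weierstrass M-test on |x| ≤ R, with majorant |γ| C (n + 1/2)(MR)ⁿ/n!.
  refine tendstoUniformlyOn_tsum_nat
    (((summable_add_half_mul_pow_div_factorial (M * R)).mul_left (|γ| * C))) fun n x hx => ?_
  have hxR : |x| ≤ R := by simpa using hR hx
  have h2 : ‖((n : ℂ) + 1 / 2) / n.factorial‖ = ((n : ℝ) + 1 / 2) / n.factorial := by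
    have : ((n : ℂ) + 1 / 2) / n.factorial = ((((n : ℝ) + 1 / 2) / n.factorial : ℝ) : ℂ) := by
      push_cast; rfl
    rw [this, norm_real, Real.norm_of_nonneg (by positivity)]
  rw [norm_mul, norm_mul, norm_mul, norm_mul, h2, norm_I, one_mul, norm_real, norm_pow, norm_real,
    Real.norm_eq_abs, Real.norm_eq_abs, mul_pow]
  have h3 : ‖(derivS ^ n) φ 0‖ * |x| ^ n ≤ C * M ^ n * R ^ n := by
    gcongr
    exact hb n
  calc |γ| * (((n : ℝ) + 1 / 2) / n.factorial * (‖(derivS ^ n) φ 0‖ * |x| ^ n))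
      ≤ |γ| * (((n : ℝ) + 1 / 2) / n.factorial * (C * M ^ n * R ^ n)) := by gcongr
    _ = _ := by ring

/-! ### Self-adjointness -/

section Abstract

variable {E : Type*} [NormedAddCommGroup E] [InnerProductSpace ℂ E]

open scoped InnerProductSpace

/-- The hypothesis makes ⟪y, x⟫ real, so the cross term, the real part of an imaginary number,
vanishes. -/
theorem norm_add_smul_sq_of_inner_comm {x y : E} (h : ⟪y, x⟫_ℂ = ⟪x, y⟫_ℂ) (c : ℝ) :
    ‖y + (I * c) • x‖ ^ 2 = ‖y‖ ^ 2 + c ^ 2 * ‖x‖ ^ 2 := by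
  have him : (⟪y, x⟫_ℂ).im = 0 := by
    rw [← conj_eq_iff_im, inner_conj_symm, h]
  rw [@norm_add_sq ℂ, inner_smul_right, norm_smul, norm_mul, norm_I, norm_real, one_mul, mul_pow,
    Real.norm_eq_abs, sq_abs]
  simp [him]

/-- The basic criterion: the closure of a densely defined symmetric operator `A` is self-adjoint
if the ranges of `A ± i c` are dense. -/
theorem isSelfAdjoint_closure [CompleteSpace E] (A : E →ₗ.[ℂ] E) (hd : Dense (A.domain : Set E))
    (hs : A.IsFormalAdjoint A) {c : ℝ} (hc : c ≠ 0)
    (hp : ∀ u : E, (∀ x : A.domain, ⟪u, A x + (I * c) • (x : E)⟫_ℂ = 0) → u = 0)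
    (hm : ∀ u : E, (∀ x : A.domain, ⟪u, A x - (I * c) • (x : E)⟫_ℂ = 0) → u = 0) :
    IsSelfAdjoint A.closure := by
  -- A symmetric operator is contained in its adjoint, which is closed.
  have hcl : A.IsClosable := (A.adjoint_isClosed hd).isClosable.leIsClosable (hs.le_adjoint hd)
  have hgr := hcl.graph_closure_eq_closure_graph
  set S : Submodule ℂ (E × E) := A.graph.topologicalClosure with hS
  have hAS : ∀ x : A.domain, ((x : E), A x) ∈ S := fun x =>
    A.graph.le_topologicalClosure (A.mem_graph x)
  have hsym1 : ∀ p ∈ S, ∀ x : A.domain, ⟪p.2, (x : E)⟫_ℂ = ⟪p.1, A x⟫_ℂ := fun p hp x => by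
    have hcl : IsClosed {p : E × E | ⟪p.2, (x : E)⟫_ℂ = ⟪p.1, A x⟫_ℂ} :=
      isClosed_eq (by fun_prop) (by fun_prop)
    refine closure_minimal (fun q hq => ?_) hcl hp
    obtain ⟨y, rfl⟩ := (LinearPMap.mem_graph_iff' A).1 hq
    exact hs y x
  have hsym : ∀ p ∈ S, ∀ q ∈ S, ⟪p.2, q.1⟫_ℂ = ⟪p.1, q.2⟫_ℂ := fun p hp q hq => by
    have hcl : IsClosed {q : E × E | ⟪p.2, q.1⟫_ℂ = ⟪p.1, q.2⟫_ℂ} :=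
      isClosed_eq (by fun_prop) (by fun_prop)
    refine closure_minimal (fun q hq => ?_) hcl hq
    obtain ⟨y, rfl⟩ := (LinearPMap.mem_graph_iff' A).1 hq
    exact hsym1 p hp y
  -- T is the closure of A plus ic, viewed on its graph. The norm identity bounds it below, so its
  -- range is closed; the first density hypothesis then makes it surjective.
  let T : S →L[ℂ] E := (ContinuousLinearMap.snd ℂ E E +
    (I * c) • ContinuousLinearMap.fst ℂ E E) ∘L S.subtypeL
  have hT : ∀ p : S, T p = (p : E × E).2 + (I * c) • (p : E × E).1 := fun p => rfl
  have hTanti : AntilipschitzWith (max 1 (1 / ‖c‖₊)) T := by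
    refine T.antilipschitz_of_bound fun p => ?_
    have h1 := norm_add_smul_sq_of_inner_comm (hsym p p.2 p p.2) c
    rw [← hT] at h1
    have h2 : ‖(p : E × E).2‖ ≤ ‖T p‖ := by
      refine le_of_sq_le_sq ?_ (norm_nonneg _)
      rw [h1]
      nlinarith [mul_nonneg (sq_nonneg c) (sq_nonneg ‖(p : E × E).1‖)]
    have h3 : |c| * ‖(p : E × E).1‖ ≤ ‖T p‖ := by
      refine le_of_sq_le_sq ?_ (norm_nonneg _)
      rw [h1, mul_pow, sq_abs]
      nlinarith [sq_nonneg ‖(p : E × E).2‖]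
    have hc' : 0 < |c| := abs_pos.2 hc
    push_cast
    rw [Submodule.coe_norm, Prod.norm_def, Real.norm_eq_abs]
    refine max_le ?_ ?_
    · calc ‖(p : E × E).1‖ ≤ 1 / |c| * ‖T p‖ := by
            rw [div_mul_eq_mul_div, one_mul, le_div_iff₀ hc', mul_comm]
            exact h3
        _ ≤ _ := by gcongr; exact le_max_right _ _
    · calc ‖(p : E × E).2‖ ≤ 1 * ‖T p‖ := by rwa [one_mul]
        _ ≤ _ := by gcongr; exact le_max_left _ _
  have : CompleteSpace S := A.graph.isClosed_topologicalClosure.completeSpace_coe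
  have hTcl : IsClosed (LinearMap.range T.toLinearMap : Set E) :=
    hTanti.isClosed_range T.uniformContinuous
  have hTtop : LinearMap.range T.toLinearMap = ⊤ := by
    have : CompleteSpace (LinearMap.range T.toLinearMap) := hTcl.completeSpace_coe
    rw [← Submodule.orthogonal_eq_bot_iff, Submodule.eq_bot_iff]
    intro u hu
    exact hp u fun x => (Submodule.mem_orthogonal' _ _).1 hu _ ⟨⟨_, hAS x⟩, rfl⟩
  have hdB : Dense (A.closure.domain : Set E) := hd.mono A.le_closure.1
  refine (LinearPMap.isSelfAdjoint_def).2 (le_antisymm ?_ ?_)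
  · refine LinearPMap.le_of_le_graph fun q hq => ?_
    obtain ⟨u, rfl⟩ := (LinearPMap.mem_graph_iff' _).1 hq
    set v := A.closure.adjoint u
    have hv : ∀ x : A.domain, ⟪v, (x : E)⟫_ℂ = ⟪(u : E), A x⟫_ℂ := fun x => by
      have h1 := LinearPMap.adjoint_isFormalAdjoint hdB u ⟨x, A.le_closure.1 x.2⟩
      rw [h1, ← A.le_closure.2 (x := x) (y := ⟨x, A.le_closure.1 x.2⟩) rfl]
    -- Surjectivity matches (A* + ic)u by some w in the closed graph. The difference of u and the
    -- first component of w is orthogonal to the range of A - ic, so it vanishes and u lies in the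
    -- domain of the closure.
    obtain ⟨w, hw⟩ : v + (I * c) • (u : E) ∈ LinearMap.range T.toLinearMap := hTtop ▸ trivial
    have hw' : (w : E × E).2 + (I * c) • (w : E × E).1 = v + (I * c) • (u : E) := hw
    have huw : (u : E) - (w : E × E).1 = 0 := by
      refine hm _ fun x => ?_
      have h1 : ⟪v - (w : E × E).2, (x : E)⟫_ℂ = ⟪(u : E) - (w : E × E).1, A x⟫_ℂ := by
        rw [inner_sub_left, inner_sub_left, hv, hsym1 w w.2]
      have h2 : v - (w : E × E).2 = -((I * c) • ((u : E) - (w : E × E).1)) := by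
        rw [smul_sub, neg_sub, sub_eq_sub_iff_add_eq_add, ← hw', add_comm]
      rw [inner_sub_right, ← h1, h2, inner_neg_left, inner_smul_left, inner_smul_right, map_mul,
        conj_I, conj_ofReal]
      ring
    have hu1 : (u : E) = (w : E × E).1 := sub_eq_zero.1 huw
    have hv1 : v = (w : E × E).2 := by
      rw [hu1] at hw'
      exact (add_right_cancel hw').symm
    rw [← hgr, hu1, hv1]
    exact w.2
  · refine LinearPMap.IsFormalAdjoint.le_adjoint hdB fun x y => ?_
    have hx : ((x : E), A.closure x) ∈ S := hgr ▸ A.closure.mem_graph x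
    have hy : ((y : E), A.closure y) ∈ S := hgr ▸ A.closure.mem_graph y
    exact hsym _ hx _ hy

end Abstract

/-- The lemma of du Bois-Reymond on an open interval. -/
theorem ae_eq_const_of_integral_deriv_smul_eq_zero {U : Set ℝ} (hU : IsOpen U)
    (hUc : U.OrdConnected) (hUn : U.Nonempty) {w : ℝ → ℂ} (hw : LocallyIntegrable w)
    (h : ∀ G : ℝ → ℝ, ContDiff ℝ ∞ G → HasCompactSupport G → tsupport G ⊆ U →
      ∫ x, deriv G x • w x = 0) : ∃ c : ℂ, ∀ᵐ x : ℝ, x ∈ U → w x = c := by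
  obtain ⟨p, hpU⟩ := hUn
  obtain ⟨ε, hε, hεU⟩ := Metric.isOpen_iff.1 hU p hpU
  let b : ContDiffBump p := ⟨ε / 4, ε / 2, by positivity, by linarith⟩
  set θ : ℝ → ℝ := b.normed volume with hθ
  have hθd : ContDiff ℝ ∞ θ := b.contDiff_normed
  have hθc : HasCompactSupport θ := b.hasCompactSupport_normed
  have hθU : tsupport θ ⊆ U := by
    rw [hθ, b.tsupport_normed_eq]
    exact (Metric.closedBall_subset_ball (show ε / 2 < ε by linarith)).trans hεU
  have hθ1 : ∫ x, θ x = 1 := b.integral_normed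
  have hiw : ∀ g : ℝ → ℝ, Continuous g → HasCompactSupport g →
      Integrable fun x => g x • w x := fun g hg hgc =>
    hw.integrable_smul_left_of_hasCompactSupport hg hgc
  refine ⟨∫ x, θ x • w x, ?_⟩
  have key := hU.ae_eq_zero_of_integral_contDiff_smul_eq_zero (μ := volume)
    (f := fun x => w x - ∫ x, θ x • w x)
    ((hw.sub (locallyIntegrable_const _)).locallyIntegrableOn U) ?_
  · filter_upwards [key] with x hx hxU
    exact sub_eq_zero.1 (hx hxU)
  intro g hg hgc hgU
  set a : ℝ := ∫ x, g x
  -- Subtracting a multiple of the normalised bump θ gives integral zero, so the primitive of g₁ has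
  -- compact support and is an admissible test function.
  set g₁ : ℝ → ℝ := fun x => g x - a * θ x with hg₁
  have hg₁d : ContDiff ℝ ∞ g₁ := hg.sub (contDiff_const.mul hθd)
  have hgi : Integrable g := hg.continuous.integrable_of_hasCompactSupport hgc
  have hθi : Integrable θ := hθd.continuous.integrable_of_hasCompactSupport hθc
  have hg₁i : Integrable g₁ := hgi.sub (hθi.const_mul a)
  have hg₁0 : ∫ x, g₁ x = 0 := by
    rw [integral_sub hgi (hθi.const_mul a), integral_const_mul, hθ1, mul_one, sub_self]
  set K : Set ℝ := tsupport g ∪ tsupport θ with hK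
  have hKc : IsCompact K := hgc.isCompact.union hθc.isCompact
  have hKn : K.Nonempty := by
    refine ⟨p, Or.inr ?_⟩
    rw [hθ, b.tsupport_normed_eq]
    exact Metric.mem_closedBall_self b.rOut_pos.le
  have hKU : K ⊆ U := Set.union_subset hgU hθU
  have hg₁K : ∀ x, x ∉ K → g₁ x = 0 := fun x hx => by
    rw [hK, Set.mem_union, not_or] at hx
    simp [hg₁, image_eq_zero_of_notMem_tsupport hx.1, image_eq_zero_of_notMem_tsupport hx.2]
  set G : ℝ → ℝ := fun x => ∫ t in Set.Iic x, g₁ t with hG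
  have hGd : ∀ x, HasDerivAt G (g₁ x) x := fun x => by
    have e : G = fun y => (∫ t in Set.Iic 0, g₁ t) + ∫ t in (0 : ℝ)..y, g₁ t := by
      funext y
      rw [← intervalIntegral.integral_Iic_sub_Iic hg₁i.integrableOn hg₁i.integrableOn]
      ring
    rw [e]
    exact (intervalIntegral.integral_hasDerivAt_right (hg₁i.intervalIntegrable)
      (hg₁d.continuous.stronglyMeasurableAtFilter _ _) hg₁d.continuous.continuousAt).const_add _
  have hGderiv : deriv G = g₁ := funext fun x => (hGd x).deriv
  have hGs : ContDiff ℝ ∞ G :=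
    contDiff_infty_iff_deriv.2 ⟨fun x => (hGd x).differentiableAt, hGderiv ▸ hg₁d⟩
  have hGK : ∀ x, x ∉ Set.Icc (sInf K) (sSup K) → G x = 0 := fun x hx => by
    rw [Set.mem_Icc, not_and_or, not_le, not_le] at hx
    rcases hx with hx | hx
    · refine setIntegral_eq_zero_of_forall_eq_zero fun t ht => hg₁K t fun htK => ?_
      exact absurd (csInf_le hKc.bddBelow htK) (not_le.2 (lt_of_le_of_lt ht hx))
    · rw [hG, ← hg₁0]
      refine setIntegral_eq_integral_of_forall_compl_eq_zero fun t ht => hg₁K t fun htK => ?_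
      exact ht ((le_csSup hKc.bddAbove htK).trans hx.le)
  have hGt : tsupport G ⊆ Set.Icc (sInf K) (sSup K) :=
    closure_minimal (fun x hx => by_contra fun hx' => hx (hGK x hx')) isClosed_Icc
  -- Order-connectedness of U is needed here: the primitive may be nonzero in gaps of K.
  have hIU : Set.Icc (sInf K) (sSup K) ⊆ U :=
    hUc.out (hKU (hKc.sInf_mem hKn)) (hKU (hKc.sSup_mem hKn))
  have h0 := h G hGs (HasCompactSupport.intro isCompact_Icc hGK) (hGt.trans hIU)
  rw [hGderiv] at h0
  have h1 : ∀ x, g₁ x • w x = g x • w x - a • (θ x • w x) := fun x => by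
    rw [hg₁, sub_smul, mul_smul]
  simp_rw [h1] at h0
  have hiθ : Integrable fun x => a • (θ x • w x) := (hiw θ hθd.continuous hθc).smul a
  rw [integral_sub (hiw g hg.continuous hgc) hiθ, integral_smul] at h0
  simp_rw [smul_sub]
  rw [integral_sub (hiw g hg.continuous hgc) (hgi.smul_const _), integral_smul_const]
  exact h0

/-! ### Density of the ranges of Ĥ ± iγ/2 -/

theorem inner_toL2_right (u : L2) (ψ : 𝓢(ℝ, ℂ)) :
    inner ℂ u (toL2 ψ) = ∫ x, ψ x * conj (u x) := by
  rw [L2.inner_def]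
  refine integral_congr_ae ?_
  have h : (toL2 ψ : ℝ → ℂ) =ᵐ[volume] ψ := SchwartzMap.coeFn_toLp ψ 2 volume
  filter_upwards [h] with x hx
  rw [hx]
  rfl

theorem memLp_conj (u : L2) : MemLp (fun x => conj (u x)) 2 (volume : Measure ℝ) :=
  (Lp.memLp u).star

theorem locallyIntegrable_conj (u : L2) : LocallyIntegrable (fun x => conj (u x)) :=
  (memLp_conj u).locallyIntegrable (by norm_num)

theorem hasDerivAt_ofReal_comp {G : ℝ → ℝ} (hG : ContDiff ℝ ∞ G) (x : ℝ) :
    HasDerivAt (fun y => (G y : ℂ)) ((deriv G x : ℝ) : ℂ) x :=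
  (hG.differentiable (by simp) x).hasDerivAt.ofReal_comp

/-- A real test function as a Schwartz function. -/
def testS {G : ℝ → ℝ} (hG : ContDiff ℝ ∞ G) (hc : HasCompactSupport G) : 𝓢(ℝ, ℂ) :=
  (hc.comp_left (g := Complex.ofReal) rfl : HasCompactSupport fun x => (G x : ℂ)).toSchwartzMap
    (Complex.ofRealCLM.contDiff.comp hG)

theorem testS_apply {G : ℝ → ℝ} (hG : ContDiff ℝ ∞ G) (hc : HasCompactSupport G) (x : ℝ) :
    testS hG hc x = G x := rfl

theorem derivS_testS_apply {G : ℝ → ℝ} (hG : ContDiff ℝ ∞ G) (hc : HasCompactSupport G) (x : ℝ) :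
    derivS (testS hG hc) x = (deriv G x : ℝ) := by
  rw [SchwartzMap.derivCLM_apply]
  exact (hasDerivAt_ofReal_comp hG x).deriv

theorem eq_zero_of_conj_ae_eq_zero {u : L2} (h : ∀ᵐ x : ℝ, conj (u x) = 0) : u = 0 := by
  refine (Lp.eq_zero_iff_ae_eq_zero).2 ?_
  filter_upwards [h] with x hx
  simpa using hx

/-- Orthogonality says that x ū has zero weak derivative, so ū = c/x almost everywhere, and c/x is
not square integrable near 0 unless c = 0. -/
theorem eq_zero_of_orthogonal_position_derivS (u : L2)
    (h : ∀ φ : 𝓢(ℝ, ℂ), inner ℂ u (toL2 (position (derivS φ))) = 0) : u = 0 := by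
  have hloc : LocallyIntegrable fun x : ℝ => (x : ℂ) * conj (u x) := by
    rw [← locallyIntegrableOn_univ]
    exact ((locallyIntegrable_conj u).locallyIntegrableOn _).continuousOn_mul
      continuous_ofReal.continuousOn isOpen_univ.isLocallyClosed
  obtain ⟨c, hc⟩ := ae_eq_const_of_integral_deriv_smul_eq_zero isOpen_univ Set.ordConnected_univ
    Set.univ_nonempty hloc fun G hG hGc _ => by
      rw [← h (testS hG hGc), inner_toL2_right]
      refine integral_congr_ae (Eventually.of_forall fun x => ?_)
      simp only [position_apply, derivS_testS_apply, real_smul]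
      ring
  have hc0 : c = 0 := by
    by_contra hc0
    have hi : IntegrableOn (fun x => ‖conj (u x)‖ ^ 2) (Set.Ioo 0 1) :=
      ((memLp_conj u).integrable_norm_pow (by norm_num)).integrableOn
    have hi2 : IntegrableOn (fun x : ℝ => x ^ (-2 : ℝ)) (Set.Ioo 0 1) := by
      refine (hi.const_mul (‖c‖ ^ 2)⁻¹).congr ?_
      refine (ae_restrict_iff' measurableSet_Ioo).2 ?_
      filter_upwards [hc] with x hx hx01
      have hx0 : 0 < x := hx01.1
      have hn : x * ‖conj (u x)‖ = ‖c‖ := by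
        rw [← hx trivial, norm_mul, norm_real, Real.norm_of_nonneg hx0.le]
      have hu0 : ‖conj (u x)‖ ≠ 0 := fun h0 => hc0 (norm_eq_zero.1 (by rw [← hn, h0, mul_zero]))
      rw [← hn, Real.rpow_neg hx0.le, Real.rpow_two]
      field_simp
    rw [intervalIntegral.integrableOn_Ioo_rpow_iff one_pos] at hi2
    norm_num at hi2
  refine eq_zero_of_conj_ae_eq_zero ?_
  have h0 : ∀ᵐ x : ℝ, x ≠ 0 := by simp [ae_iff]
  filter_upwards [hc, h0] with x hx hx0
  have := hx trivial
  rw [hc0] at this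
  exact (mul_eq_zero.1 this).resolve_left (ofReal_ne_zero.2 hx0)

/-- Away from 0 every test function has the form xφ, so ū is constant on U. A constant that is
square integrable on a set of infinite measure is zero. -/
theorem ae_eq_zero_of_orthogonal_derivS_position (u : L2)
    (h : ∀ φ : 𝓢(ℝ, ℂ), inner ℂ u (toL2 (derivS (position φ))) = 0) {U : Set ℝ} (hU : IsOpen U)
    (hUc : U.OrdConnected) (hUn : U.Nonempty) (hU0 : (0 : ℝ) ∉ U) (hUv : volume U = ⊤) :
    ∀ᵐ x : ℝ, x ∈ U → conj (u x) = 0 := by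
  obtain ⟨c, hc⟩ := ae_eq_const_of_integral_deriv_smul_eq_zero hU hUc hUn
    (locallyIntegrable_conj u) fun G hG hGc hGU => by
      -- Division by x preserves smoothness because G vanishes near 0.
      have hH : ContDiff ℝ ∞ fun x : ℝ => x⁻¹ * G x := contDiff_iff_contDiffAt.2 fun x => by
        by_cases hx0 : x = 0
        · have hx : x ∉ tsupport G := fun hx => hU0 (hx0 ▸ hGU hx)
          refine (contDiffAt_const (c := (0 : ℝ))).congr_of_eventuallyEq ?_
          filter_upwards [notMem_tsupport_iff_eventuallyEq.1 hx] with y hy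
          rw [hy, Pi.zero_apply, mul_zero]
        · exact (contDiffAt_inv ℝ hx0).mul hG.contDiffAt
      have e : position (testS hH hGc.mul_left) = testS hG hGc := by
        ext x
        rw [position_apply, testS_apply, testS_apply, ← ofReal_mul]
        by_cases hx0 : x = 0
        · have : G x = 0 := image_eq_zero_of_notMem_tsupport fun hx => hU0 (hx0 ▸ hGU hx)
          simp [this]
        · rw [mul_inv_cancel_left₀ hx0]
      rw [← h (testS hH hGc.mul_left), inner_toL2_right, e]
      simp_rw [derivS_testS_apply, real_smul]
  have hm : MemLp (fun _ : ℝ => c) 2 (volume.restrict U) :=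
    ((memLp_conj u).restrict U).ae_eq ((ae_restrict_iff' hU.measurableSet).2 hc)
  rw [memLp_const_iff (by norm_num) (by norm_num), Measure.restrict_apply_univ, hUv] at hm
  have hc0 : c = 0 := by simpa using hm
  rwa [hc0] at hc

theorem eq_zero_of_orthogonal_derivS_position (u : L2)
    (h : ∀ φ : 𝓢(ℝ, ℂ), inner ℂ u (toL2 (derivS (position φ))) = 0) : u = 0 := by
  refine eq_zero_of_conj_ae_eq_zero ?_
  have h0 : ∀ᵐ x : ℝ, x ≠ 0 := by simp [ae_iff]
  filter_upwards [h0, ae_eq_zero_of_orthogonal_derivS_position u h (U := Set.Ioi 0) isOpen_Ioi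
    Set.ordConnected_Ioi ⟨1, by simp⟩ (by simp) Real.volume_Ioi,
    ae_eq_zero_of_orthogonal_derivS_position u h (U := Set.Iio 0) isOpen_Iio Set.ordConnected_Iio
    ⟨-1, by simp⟩ (by simp) Real.volume_Iio] with x hx hp hm
  exact hx.lt_or_gt.elim hm hp

theorem toL2_mem_domain (γ : ℝ) (φ : 𝓢(ℝ, ℂ)) : toL2 φ ∈ (hamiltonianCore γ).domain := ⟨φ, rfl⟩

theorem hamiltonianCore_toL2 (γ : ℝ) (φ : 𝓢(ℝ, ℂ)) (h : toL2 φ ∈ (hamiltonianCore γ).domain) :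
    hamiltonianCore γ ⟨toL2 φ, h⟩ = toL2 (hamiltonianSchwartz γ φ) := by
  obtain ⟨h1, h2⟩ := hamiltonian_toL2 γ φ
  rw [← h2]
  exact (hamiltonianCore γ).le_closure.2 rfl

theorem hamiltonian_isSelfAdjoint {γ : ℝ} (hγ : 0 < γ) : IsSelfAdjoint (hamiltonian γ) := by
  have hIγ : (I * γ : ℂ) ≠ 0 := mul_ne_zero I_ne_zero (ofReal_ne_zero.2 hγ.ne')
  -- At c = γ/2 the zeroth-order terms combine so that Ĥ ± ic are iγ times D x and x D, for which
  -- orthogonality is a du Bois-Reymond problem.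
  refine isSelfAdjoint_closure (hamiltonianCore γ) ?_ ?_ (c := γ / 2) (by positivity) ?_ ?_
  · exact SchwartzMap.denseRange_toLpCLM ENNReal.ofNat_ne_top
  · rintro ⟨_, φ, rfl⟩ ⟨_, ψ, rfl⟩
    exact (congrArg (inner ℂ · (toL2 ψ)) (hamiltonianCore_toL2 γ φ ⟨φ, rfl⟩)).trans
      ((inner_hamiltonianSchwartz γ φ ψ).trans
        (congrArg (inner ℂ (toL2 φ)) (hamiltonianCore_toL2 γ ψ ⟨ψ, rfl⟩)).symm)
  · refine fun u hu => eq_zero_of_orthogonal_derivS_position u fun φ => ?_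
    have h1 : inner ℂ u (hamiltonianCore γ ⟨toL2 φ, toL2_mem_domain γ φ⟩ +
        (I * ((γ / 2 : ℝ) : ℂ)) • toL2 φ) = 0 := hu ⟨toL2 φ, toL2_mem_domain γ φ⟩
    have e : hamiltonianSchwartz γ φ + (I * ((γ / 2 : ℝ) : ℂ)) • φ =
        (I * γ) • derivS (position φ) := by
      rw [hamiltonianSchwartz_eq, derivS_position]
      push_cast
      module
    rw [hamiltonianCore_toL2, ← map_smul, ← map_add, e, map_smul, inner_smul_right] at h1
    exact (mul_eq_zero.1 h1).resolve_left hIγ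
  · refine fun u hu => eq_zero_of_orthogonal_position_derivS u fun φ => ?_
    have h1 : inner ℂ u (hamiltonianCore γ ⟨toL2 φ, toL2_mem_domain γ φ⟩ -
        (I * ((γ / 2 : ℝ) : ℂ)) • toL2 φ) = 0 := hu ⟨toL2 φ, toL2_mem_domain γ φ⟩
    have e : hamiltonianSchwartz γ φ - (I * ((γ / 2 : ℝ) : ℂ)) • φ =
        (I * γ) • position (derivS φ) := by
      rw [hamiltonianSchwartz_eq]
      push_cast
      module
    rw [hamiltonianCore_toL2, ← map_smul, ← map_sub, e, map_smul, inner_smul_right] at h1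
    exact (mul_eq_zero.1 h1).resolve_left hIγ

end DampedQuantum

end

/-- Absolute convergence is contained in `HasSum`, since unconditional and absolute convergence
agree in ℂ. -/
theorem mainTheorem3 (γ : ℝ) (hγ : 0 < γ) :
    IsSelfAdjoint (DampedQuantum.hamiltonian γ) ∧
    (∀ n : ℕ,
      DampedQuantum.IsGeneralizedEigenvector (DampedQuantum.hamiltonianSchwartz γ)
        (conj (DampedQuantum.energy γ n)) (DampedQuantum.fMinus n) ∧
      DampedQuantum.IsGeneralizedEigenvector (DampedQuantum.hamiltonianSchwartz γ)
        (DampedQuantum.energy γ n) (DampedQuantum.fPlus n)) ∧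
    (∀ φ ∈ DampedQuantum.PhiMinus γ,
      ∃ h : DampedQuantum.toL2 φ ∈ (DampedQuantum.hamiltonian γ).domain,
        ∀ χ ∈ DampedQuantum.PhiPlus γ ∪ DampedQuantum.spaceZ,
          HasSum
            (fun n : ℕ => conj (DampedQuantum.energy γ n) *
              (DampedQuantum.ket χ (DampedQuantum.fMinus n) *
                DampedQuantum.bra (DampedQuantum.fPlus n) φ))
            (inner ℂ (DampedQuantum.toL2 χ) (DampedQuantum.hamiltonian γ ⟨DampedQuantum.toL2 φ, h⟩))) ∧
    (∀ φ ∈ DampedQuantum.PhiPlus γ,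
      ∃ h : DampedQuantum.toL2 φ ∈ (DampedQuantum.hamiltonian γ).domain,
        (∀ χ ∈ DampedQuantum.PhiMinus γ ∪ DampedQuantum.spaceD,
          HasSum
            (fun n : ℕ => DampedQuantum.energy γ n *
              (DampedQuantum.ket χ (DampedQuantum.fPlus n) *
                DampedQuantum.bra (DampedQuantum.fMinus n) φ))
            (inner ℂ (DampedQuantum.toL2 χ) (DampedQuantum.hamiltonian γ ⟨DampedQuantum.toL2 φ, h⟩))) ∧
        ∃ g : ℝ → ℂ, (DampedQuantum.hamiltonian γ ⟨DampedQuantum.toL2 φ, h⟩ : ℝ → ℂ) =ᵐ[volume] g ∧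
          TendstoLocallyUniformly
            (fun (N : ℕ) (x : ℝ) => ∑ n ∈ Finset.range N, DampedQuantum.energy γ n *
              ((x : ℂ) ^ n / (Real.sqrt (n.factorial : ℝ) : ℂ) *
                DampedQuantum.bra (DampedQuantum.fMinus n) φ))
            g atTop) := by
  have hH (φ : 𝓢(ℝ, ℂ)) := DampedQuantum.hamiltonian_toL2 γ φ
  refine ⟨DampedQuantum.hamiltonian_isSelfAdjoint hγ,
    fun n => ⟨DampedQuantum.isGeneralizedEigenvector_fMinus γ n,
      DampedQuantum.isGeneralizedEigenvector_fPlus γ n⟩, fun φ hφ => ?_, fun φ hφ => ?_⟩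
  · obtain ⟨h, e⟩ := hH φ
    refine ⟨h, fun χ hχ => ?_⟩
    rw [e]
    exact DampedQuantum.hasSum_energy_fMinus_fPlus γ (DampedQuantum.PhiMinus_subset_spaceD hγ hφ)
      (hχ.elim (fun h => DampedQuantum.PhiPlus_subset_spaceZ hγ h) id)
  · obtain ⟨h, e⟩ := hH φ
    have hZ := DampedQuantum.PhiPlus_subset_spaceZ hγ hφ
    -- The continuous representative g of Ĥφ is the Schwartz function itself.
    refine ⟨h, fun χ hχ => ?_, DampedQuantum.hamiltonianSchwartz γ φ, ?_,
      DampedQuantum.tendstoLocallyUniformly_energy γ hZ⟩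
    · rw [e]
      exact DampedQuantum.hasSum_energy_fPlus_fMinus γ hZ
        (hχ.elim (fun h => DampedQuantum.PhiMinus_subset_spaceD hγ h) id)
    · rw [e]
      exact SchwartzMap.coeFn_toLp _ 2 volume
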